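/- Let $n\ge 2$ and let $\omega=\sum_{i=1}^n dq_i\wedge dp_i$ be the standard symplectic form on $\mathbb R^{2n}$. Let $X\subset\mathbb R^{2n}$ be a convex body with the origin in its interior and with $C^\infty$-smooth boundary, and suppose that $X$ is symplectically self-polar, i.e. $X=X^\omega$, where $$X^\omega=\{y\in\mathbb R^{2n}:\ \omega(x,y)\le 1\ \text{ for all } x\in X\}.$$ Let $f\colon\partial X\to\partial X^\omega=\partial X$ be the map uniquely determined by $\omega(x,f(x))=1$ for all $x\in\partial X$. A characteristic of $\partial X$ is a regular $C^1$ curve $\gamma\colon I\to\partial X$ on an open interval $I$ with $\dot\gamma(t)\in\ker\big(\omega|_{T_{\gamma(t)}\partial X}\big)$ for all $t\in I$. If $f$ maps characteristics of $\partial X$ to characteristics of $\partial X$, i.e. $f\circ\gamma$ is a characteristic of $\partial X$ for every characteristic $\gamma$ of $\partial X$, then $X$ is linearly symplectomorphic to the closed unit Euclidean ball $B\subset\mathbb R^{2n}$: there is a linear bijection $\Phi$ of $\mathbb R^{2n}$ with $\omega(\Phi x,\Phi y)=\omega(x,y)$ for all $x,y$ and $\Phi(X)=B$. -/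

import Mathlib

open scoped ContDiff Topology

/-- The standard symplectic vector space `ℝ²ⁿ` with its Euclidean structure. A vector `x` has
position coordinates `x (Sum.inl i)` and momentum coordinates `x (Sum.inr i)`. -/
abbrev SympSpace (n : ℕ) : Type := EuclideanSpace ℝ (Fin n ⊕ Fin n)

/-- The standard linear symplectic form `ω = ∑ dqᵢ ∧ dpᵢ`. -/
def sympForm {n : ℕ} (x y : SympSpace n) : ℝ :=
  ∑ i : Fin n, (x (Sum.inl i) * y (Sum.inr i) - x (Sum.inr i) * y (Sum.inl i))

/-- The symplectic polar `X^ω = {y | ∀ x ∈ X, ω(x, y) ≤ 1}`. -/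
def symplecticPolar {n : ℕ} (X : Set (SympSpace n)) : Set (SympSpace n) :=
  {y | ∀ x ∈ X, sympForm x y ≤ 1}

/-- `X` is symplectically self-polar if `X = X^ω`. -/
def IsSymplecticallySelfPolar {n : ℕ} (X : Set (SympSpace n)) : Prop :=
  X = symplecticPolar X

/-- `ρ` is a local `C^k` defining function of the domain `X` near the boundary point `x`:
on some open neighbourhood `U` of `x` the function `ρ` is `C^k`, `X` is the sublevel set
`{ρ ≤ 0}`, and the differential of `ρ` at `x` is nonzero. -/
def IsDefiningFunctionAt {n : ℕ} (k : WithTop ℕ∞) (X : Set (SympSpace n)) (x : SympSpace n)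
    (ρ : SympSpace n → ℝ) : Prop :=
  ∃ U : Set (SympSpace n), IsOpen U ∧ x ∈ U ∧ ContDiffOn ℝ k ρ U ∧
    (∀ y ∈ U, y ∈ X ↔ ρ y ≤ 0) ∧ fderiv ℝ ρ x ≠ 0

/-- `X` has `C^k`-smooth boundary: near each boundary point it has a `C^k` defining function. -/
def HasSmoothBoundary {n : ℕ} (k : WithTop ℕ∞) (X : Set (SympSpace n)) : Prop :=
  ∀ x ∈ frontier X, ∃ ρ : SympSpace n → ℝ, IsDefiningFunctionAt k X x ρ

/-- The tangent space `T_x ∂X` at a boundary point `x`: the kernel of the differential of a local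
defining function (the kernel does not depend on the defining function). -/
def boundaryTangent {n : ℕ} (X : Set (SympSpace n)) (x : SympSpace n) : Set (SympSpace n) :=
  {v | ∃ ρ : SympSpace n → ℝ, IsDefiningFunctionAt 1 X x ρ ∧ fderiv ℝ ρ x v = 0}

/-- The characteristic line `ker (ω|_{T_x ∂X}) ⊆ T_x ∂X` of `∂X` at `x`. -/
def characteristicLine {n : ℕ} (X : Set (SympSpace n)) (x : SympSpace n) : Set (SympSpace n) :=
  {v | v ∈ boundaryTangent X x ∧ ∀ w ∈ boundaryTangent X x, sympForm v w = 0}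

/-- A characteristic (curve) of `∂X`, parametrized by the open interval `I`: a regular `C^1` curve
on `∂X` whose velocity lies in the characteristic line at every time. -/
def IsCharacteristicCurve {n : ℕ} (X : Set (SympSpace n)) (I : Set ℝ) (γ : ℝ → SympSpace n) :
    Prop :=
  ContDiffOn ℝ 1 γ I ∧
    ∀ t ∈ I, γ t ∈ frontier X ∧ deriv γ t ≠ 0 ∧ deriv γ t ∈ characteristicLine X (γ t)

/-- The map `f : ∂X → ∂X^ω` determined by `ω(x, f(x)) = 1`. For a convex body with the origin in
its interior and `C^1` boundary, such a point exists and is unique for every `x ∈ ∂X`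
(see `existsUnique_polarityMap`); off `∂X` the value is irrelevant. -/
noncomputable def polarityMap {n : ℕ} (X : Set (SympSpace n)) (x : SympSpace n) : SympSpace n :=
  Classical.epsilon fun y => y ∈ frontier (symplecticPolar X) ∧ sympForm x y = 1

/-- `f` maps characteristics of `∂X` to characteristics of `∂X`. -/
def MapsCharacteristics {n : ℕ} (X : Set (SympSpace n)) (f : SympSpace n → SympSpace n) : Prop :=
  ∀ (I : Set ℝ) (γ : ℝ → SympSpace n), IsOpen I → I.OrdConnected →
    IsCharacteristicCurve X I γ → IsCharacteristicCurve X I (f ∘ γ)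

/-- `X` and `Y` are linearly symplectomorphic. -/
def LinearlySymplectomorphic {n : ℕ} (X Y : Set (SympSpace n)) : Prop :=
  ∃ Φ : SympSpace n ≃ₗ[ℝ] SympSpace n,
    (∀ x y, sympForm (Φ x) (Φ y) = sympForm x y) ∧ Φ '' X = Y

theorem sympForm_add_left {n : ℕ} (x x' y : SympSpace n) :
    sympForm (x + x') y = sympForm x y + sympForm x' y := by
  simp only [sympForm, PiLp.add_apply, ← Finset.sum_add_distrib]
  exact Finset.sum_congr rfl fun i _ => by ring

theorem sympForm_smul_left {n : ℕ} (c : ℝ) (x y : SympSpace n) :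
    sympForm (c • x) y = c * sympForm x y := by
  simp only [sympForm, PiLp.smul_apply, smul_eq_mul, Finset.mul_sum]
  exact Finset.sum_congr rfl fun i _ => by ring

theorem sympForm_smul_right {n : ℕ} (c : ℝ) (x y : SympSpace n) :
    sympForm x (c • y) = c * sympForm x y := by
  simp only [sympForm, PiLp.smul_apply, smul_eq_mul, Finset.mul_sum]
  exact Finset.sum_congr rfl fun i _ => by ring

theorem continuous_sympForm_right {n : ℕ} (x : SympSpace n) :
    Continuous fun y : SympSpace n => sympForm x y := by
  unfold sympForm
  fun_prop

theorem continuous_sympForm_left {n : ℕ} (y : SympSpace n) :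
    Continuous fun x : SympSpace n => sympForm x y := by
  unfold sympForm
  fun_prop

theorem sympForm_ext {n : ℕ} {y y' : SympSpace n}
    (h : ∀ v, sympForm v y = sympForm v y') : y = y' := by
  ext j
  rcases j with i | i
  · have := h (EuclideanSpace.single (Sum.inr i) (1 : ℝ))
    simpa [sympForm, Finset.sum_ite_eq] using this
  · have := h (EuclideanSpace.single (Sum.inl i) (1 : ℝ))
    simpa [sympForm, Finset.sum_ite_eq] using this

theorem exists_sympForm_eq {n : ℕ} (g : SympSpace n →L[ℝ] ℝ) :
    ∃ y : SympSpace n, ∀ v, sympForm v y = g v := by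
  obtain ⟨z, hz⟩ : ∃ z : SympSpace n, ∀ v, inner ℝ z v = g v :=
    ⟨(InnerProductSpace.toDual ℝ (SympSpace n)).symm g, fun v => by simp⟩
  refine ⟨WithLp.toLp 2 (Sum.elim (fun i => -z (Sum.inr i)) (fun i => z (Sum.inl i))), fun v => ?_⟩
  rw [← hz v]
  simp [sympForm, PiLp.inner_apply, Finset.sum_add_distrib]

theorem isClosed_symplecticPolar {n : ℕ} (X : Set (SympSpace n)) :
    IsClosed (symplecticPolar X) := by
  have : symplecticPolar X = ⋂ x ∈ X, {y | sympForm x y ≤ 1} := by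
    ext y; simp [symplecticPolar]
  rw [this]
  exact isClosed_biInter fun x _ => isClosed_le (continuous_sympForm_right x) continuous_const

/-- Well-definedness of `f : ∂X → ∂X^ω`. -/
theorem existsUnique_polarityMap {n : ℕ} (X : ConvexBody (SympSpace n))
    (h0 : (0 : SympSpace n) ∈ interior (X : Set (SympSpace n)))
    (hX : HasSmoothBoundary 1 (X : Set (SympSpace n))) {x : SympSpace n}
    (hx : x ∈ frontier (X : Set (SympSpace n))) :
    ∃! y, y ∈ frontier (symplecticPolar (X : Set (SympSpace n))) ∧ sympForm x y = 1 := by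
  have hcl : IsClosed (X : Set (SympSpace n)) := X.isClosed
  have hxX : x ∈ (X : Set (SympSpace n)) := hcl.frontier_subset hx
  have hxint : x ∉ interior (X : Set (SympSpace n)) := hx.2
  refine existsUnique_of_exists_of_unique ?_ ?_
  · obtain ⟨g, hg⟩ := geometric_hahn_banach_open_point X.convex.interior
      isOpen_interior hxint
    have hpos : 0 < g x := by simpa using hg 0 h0
    obtain ⟨y, hy⟩ := exists_sympForm_eq ((g x)⁻¹ • g)
    have hyx : sympForm x y = 1 := by
      rw [hy]; simp [hpos.ne']
    have hmem : y ∈ symplecticPolar (X : Set (SympSpace n)) := by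
      intro a ha
      have hcl2 : a ∈ closure (interior (X : Set (SympSpace n))) := by
        rw [X.convex.closure_interior_eq_closure_of_nonempty_interior ⟨0, h0⟩]
        exact subset_closure ha
      have hle : closure (interior (X : Set (SympSpace n))) ⊆ {a | g a ≤ g x} :=
        closure_minimal (fun b hb => (hg b hb).le) (isClosed_le g.continuous continuous_const)
      have : g a ≤ g x := hle hcl2
      rw [hy]
      simp only [FunLike.coe_smul, Pi.smul_apply, smul_eq_mul]
      rw [inv_mul_le_iff₀ hpos]; simpa using this
    refine ⟨y, ⟨subset_closure hmem, fun hint => ?_⟩, hyx⟩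
    have htend : Filter.Tendsto (fun s : ℝ => s • y) (𝓝[>] 1) (𝓝 y) := by
      have : Continuous fun s : ℝ => s • y := by fun_prop
      simpa using (this.tendsto 1).mono_left nhdsWithin_le_nhds
    obtain ⟨s, hs1, hs2⟩ := ((htend.eventually (mem_interior_iff_mem_nhds.mp hint)).and
      self_mem_nhdsWithin).exists
    have h1 : sympForm x (s • y) ≤ 1 := hs1 x hxX
    rw [sympForm_smul_right, hyx] at h1
    have : (1 : ℝ) < s := hs2
    linarith
  · obtain ⟨ρ, U, hU, hxU, hρ, hXU, hne⟩ := hX x hx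
    have hd : HasFDerivAt ρ (fderiv ℝ ρ x) x :=
      ((hρ.contDiffAt (hU.mem_nhds hxU)).differentiableAt (by norm_num)).hasFDerivAt
    have hρ0 : ρ x = 0 := by
      refine le_antisymm ((hXU x hxU).1 hxX) (not_lt.1 fun hlt => hxint ?_)
      rw [mem_interior_iff_mem_nhds]
      filter_upwards [hU.mem_nhds hxU, hd.continuousAt.eventually (gt_mem_nhds hlt)] with a ha ha'
      exact (hXU a ha).2 ha'.le
    obtain ⟨v₀, hv₀⟩ : ∃ v, fderiv ℝ ρ x v < 0 := by
      obtain ⟨v, hv⟩ : ∃ v, fderiv ℝ ρ x v ≠ 0 := by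
        by_contra! h
        exact hne (ContinuousLinearMap.ext h)
      rcases lt_or_gt_of_ne hv with h | h
      · exact ⟨v, h⟩
      · exact ⟨-v, by simpa using h⟩
    have key : ∀ y, y ∈ frontier (symplecticPolar (X : Set (SympSpace n))) ∧ sympForm x y = 1 →
        ∀ v, sympForm v y = fderiv ℝ ρ x v / fderiv ℝ ρ x x := by
      rintro y ⟨hyf, hyx⟩
      have hyp : y ∈ symplecticPolar (X : Set (SympSpace n)) :=
        (isClosed_symplecticPolar _).frontier_subset hyf
      have hneg : ∀ v, fderiv ℝ ρ x v < 0 → sympForm v y ≤ 0 := by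
        intro v hv
        have hline : HasDerivAt (fun t : ℝ => x + t • v) v 0 := by
          simpa using ((hasDerivAt_id (0 : ℝ)).smul_const v).const_add x
        have hcomp : HasDerivAt (fun t : ℝ => ρ (x + t • v)) (fderiv ℝ ρ x v) 0 := by
          have hd' : HasFDerivAt ρ (fderiv ℝ ρ x) (x + (0 : ℝ) • v) := by simpa using hd
          exact hd'.comp_hasDerivAt 0 hline
        have hslope := hcomp.tendsto_slope_zero_right
        have hev := hslope.eventually (gt_mem_nhds hv)
        have hUev : ∀ᶠ t : ℝ in 𝓝[>] 0, x + t • v ∈ U := by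
          have : Filter.Tendsto (fun t : ℝ => x + t • v) (𝓝[>] 0) (𝓝 x) := by
            simpa using hline.continuousAt.tendsto.mono_left nhdsWithin_le_nhds
          exact this.eventually (hU.mem_nhds hxU)
        obtain ⟨t, ⟨ht1, ht2⟩, ht3⟩ := ((hev.and hUev).and self_mem_nhdsWithin).exists
        have htpos : (0 : ℝ) < t := ht3
        have hρt : ρ (x + t • v) < 0 := by
          simp only [zero_add, zero_smul, add_zero, hρ0, sub_zero, smul_eq_mul] at ht1
          by_contra! hcon
          exact absurd ht1 (not_lt.2 (mul_nonneg (inv_nonneg.2 htpos.le) hcon))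
        have h1 : sympForm (x + t • v) y ≤ 1 := hyp _ ((hXU _ ht2).2 hρt.le)
        rw [sympForm_add_left, sympForm_smul_left, hyx] at h1
        have h2 : t * sympForm v y ≤ 0 := by linarith
        exact nonpos_of_mul_nonpos_right h2 htpos
      have hker : ∀ w, fderiv ℝ ρ x w = 0 → sympForm w y = 0 := by
        intro w hw
        by_contra hne'
        have h1 := hneg (v₀ + ((1 - sympForm v₀ y) / sympForm w y) • w) (by simpa [hw] using hv₀)
        rw [sympForm_add_left, sympForm_smul_left, div_mul_cancel₀ _ hne'] at h1
        linarith
      have hxx : fderiv ℝ ρ x x ≠ 0 := fun h => by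
        have := hker x h
        rw [hyx] at this
        exact one_ne_zero this
      intro v
      have h1 := hker (v + (-(fderiv ℝ ρ x v / fderiv ℝ ρ x x)) • x) (by
        simp only [map_add, map_smul, smul_eq_mul]
        field_simp
        ring)
      rw [sympForm_add_left, sympForm_smul_left, hyx] at h1
      linarith
    intro y₁ y₂ h₁ h₂
    exact sympForm_ext fun v => by rw [key y₁ h₁ v, key y₂ h₂ v]

/-! Let `F` be the symplectic gradient of half the squared gauge of `X`. It is smooth off the origin
and positively 1-homogeneous, it restricts to the polarity map on the boundary, and its integral
curves there are characteristics. Self-polarity becomes `F ∘ F = -id`. Along a characteristic with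
velocity `F`, the image has velocity `DF(x) F(x)`, which must be parallel to `F (F x) = -x`; hence
`DF(x) F(x) = μ(x) x`. The theorem follows by showing that `F` is linear.

Local step (`fderiv_comp_self_eq_neg`). The form `ω(·, DF ·)` is symmetric, being the Hessian of
half the squared gauge. Differentiating `DF(F) = μ · id` and antisymmetrising removes the second
derivative of `F` and leaves `DF² = μ`. Differentiating once more, and testing on a nonzero vector
ω-orthogonal to both `x` and `F x` (this is where `n ≥ 2` enters), gives `dμ = 0`. Then `F ∘ F =
-id` and convexity force `μ = -1`, so every `DF(x)` is an ω-compatible complex structure.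

Global step (`fderiv_eq_of_comp_self_eq_neg`). Relative to the position and momentum coordinates `q`
and `p`, a compatible complex structure `J` is encoded by the complex matrix `(p - i pJ)(q - i
qJ)⁻¹`, as in the Siegel half space. In the local coordinates `q - i q ∘ F` the matrix of `DF(x)`
depends holomorphically on `x`, because the second derivative of `F` is symmetric. It is also
0-homogeneous, so its columns attain their maximal norm on the sphere, and the maximum principle
makes them constant.

Thus `DF` is a constant `J`, the squared gauge is the quadratic form `ω(x, J x)`, and a unitary
basis for `J` carries `X` to the unit ball (`exists_symplectic_orthonormal`). -/

/-! ### Local rigidity: the derivative of the Hamiltonian field squares to `-1`. -/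

section LocalRigidity

variable {E : Type*} [NormedAddCommGroup E] [NormedSpace ℝ E]

theorem alternating_neg {σ : E →L[ℝ] E →L[ℝ] ℝ} (hσ : ∀ u, σ u u = 0) (u v : E) :
    σ u v = -σ v u := by
  have := hσ (u + v)
  simp only [map_add, add_apply, hσ] at this
  linarith

/-- Pointwise algebra behind `DF² = μ`: `D` is the derivative of `F` at `x`, `T` its second
derivative, and `c` the derivative of `μ`. -/
theorem comp_self_eq_of_derivative_identity {σ : E →L[ℝ] E →L[ℝ] ℝ} (hσ : ∀ u, σ u u = 0)
    (hnd : ∀ v, (∀ u, σ u v = 0) → v = 0) {x y : E} (hxy : σ x y ≠ 0)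
    (D : E →L[ℝ] E) (T : E → E → E) (c : E → ℝ) (m : ℝ)
    (hDx : D x = y) (hDy : D y = m • x) (hD : ∀ u v, σ u (D v) = σ v (D u))
    (hT : ∀ w u v, σ u (T w v) = σ v (T w u)) (hTs : ∀ u v, T u v = T v u)
    (hE : ∀ w, T w y + D (D w) = c w • x + m • w) :
    (∀ w, D (D w) = m • w) ∧ ∀ w, c w * σ y x = c y * σ w x := by
  have alt := alternating_neg hσ
  have hDD : ∀ u v, σ u (D (D v)) = -σ v (D (D u)) := fun u v => by
    rw [hD u (D v), alt (D v), hD v (D u)]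
  -- Pair `hE w` with `u` and `hE u` with `w` and subtract: the `T` terms are symmetric in `u, w`
  -- and cancel, while `σ u (D (D w))` is antisymmetric and doubles.
  have key : ∀ u w, 2 * (σ u (D (D w)) - m * σ u w) = c w * σ u x - c u * σ w x := by
    intro u w
    have h1 := congrArg (σ u) (hE w)
    have h2 := congrArg (σ w) (hE u)
    simp only [map_add, map_smul, smul_eq_mul] at h1 h2
    have h3 : σ u (T w y) = σ w (T u y) := by
      rw [hTs w y, hTs u y, hT]
    linarith [hDD u w, alt u w, mul_comm m (σ u w), congrArg (m * ·) (alt u w)]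
  have hRy : D (D y) = m • y := by rw [hDy, map_smul, hDx]
  have hyx : σ y x ≠ 0 := by rw [alt]; exact neg_ne_zero.2 hxy
  -- Taking `u = y` in `key` kills the left side, since `D² y = m y`. So `c` is proportional to `σ ·
  -- x`, and the right side of `key` then vanishes for all `u, w`.
  have hc : ∀ w, c w * σ y x = c y * σ w x := by
    intro w
    have h1 := key w y
    rw [hRy] at h1
    simp only [map_smul, smul_eq_mul] at h1
    linarith
  refine ⟨fun w => ?_, hc⟩
  rw [← sub_eq_zero]
  refine hnd _ fun u => ?_
  have h1 := key u w
  have h2 : c w * σ u x - c u * σ w x = 0 := by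
    have : (c w * σ u x - c u * σ w x) * σ y x = 0 := by
      linear_combination σ u x * hc w - σ w x * hc u
    exact (mul_eq_zero.1 this).resolve_right hyx
  simp only [map_sub, map_smul, smul_eq_mul]
  linarith

/-- Once `D² = m`, the first differentiated identity reduces to `T y w = c w • x`. The σ-complement
of `x` and `y` is `D`-stable and `c` vanishes on it, so the derivative of `D² = μ` in direction `y`,
applied to `v`, reads `0 = c y • v`. Since `c` is a multiple of `σ · x`, it is zero as soon as `c y`
is. -/
theorem factor_derivative_eq_zero {σ : E →L[ℝ] E →L[ℝ] ℝ} (hσ : ∀ u, σ u u = 0)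
    {x y : E} (hxy : σ x y ≠ 0)
    (D : E →L[ℝ] E) (T : E → E →L[ℝ] E) (c : E → ℝ) (m : ℝ)
    (hDx : D x = y) (hD : ∀ u v, σ u (D v) = σ v (D u)) (hTs : ∀ u v, T u v = T v u)
    (hE : ∀ w, T w y + D (D w) = c w • x + m • w) (hDD : ∀ w, D (D w) = m • w)
    (hc : ∀ w, c w * σ y x = c y * σ w x)
    (hE2 : ∀ w v, T w (D v) + D (T w v) = c w • v)
    {v : E} (hv : v ≠ 0) (hvx : σ v x = 0) (hvy : σ v y = 0) (w : E) : c w = 0 := by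
  have alt := alternating_neg hσ
  have hyx : σ y x ≠ 0 := by rw [alt]; exact neg_ne_zero.2 hxy
  have hTy : ∀ w, T y w = c w • x := fun w => by
    have := hE w
    rw [hDD, hTs] at this
    exact add_right_cancel this
  have hc0 : ∀ w, σ w x = 0 → c w = 0 := fun w hw => by
    have := hc w
    rw [hw, mul_zero] at this
    exact (mul_eq_zero.1 this).resolve_right hyx
  have h1 : σ (D v) x = 0 := by rw [alt, hD, hDx, hvy, neg_zero]
  have h2 := hE2 y v
  rw [hTy, hTy, hc0 _ h1, hc0 _ hvx] at h2
  have hcy : c y = 0 := by simpa [hv, eq_comm] using h2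
  have := hc w
  rw [hcy, zero_mul] at this
  exact (mul_eq_zero.1 this).resolve_right hyx

/-- The symplectic gradient `F` of a positively 2-homogeneous function with `F ∘ F = -id` whose
trajectories are planar has a complex structure as its derivative at every point. -/
theorem fderiv_comp_self_eq_neg {σ : E →L[ℝ] E →L[ℝ] ℝ} (hσ : ∀ u, σ u u = 0)
    (hnd : ∀ v, (∀ u, σ u v = 0) → v = 0) {F : E → E}
    (hrank : 1 < Module.rank ℝ E)
    (hF : ∀ x, x ≠ 0 → ContDiffAt ℝ ∞ F x)
    (hsym : ∀ x, x ≠ 0 → ∀ u v, σ u (fderiv ℝ F x v) = σ v (fderiv ℝ F x u))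
    (heuler : ∀ x, x ≠ 0 → fderiv ℝ F x x = F x)
    (hpos : ∀ x, x ≠ 0 → 0 < σ x (F x))
    (hmono : ∀ x, x ≠ 0 → ∀ v, 0 ≤ σ v (fderiv ℝ F x v))
    (hinv : ∀ x, x ≠ 0 → F (F x) = -x)
    (hplanar : ∀ x, x ≠ 0 → ∃ m : ℝ, fderiv ℝ F x (F x) = m • x)
    (hW : ∀ x y : E, ∃ v, v ≠ 0 ∧ σ v x = 0 ∧ σ v y = 0)
    {x : E} (hx : x ≠ 0) (v : E) : fderiv ℝ F x (fderiv ℝ F x v) = -v := by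
  have alt := alternating_neg hσ
  -- The factor from `hplanar` is recovered by pairing with `F x`; this explicit quotient is
  -- differentiable.
  set μ : E → ℝ := fun x => σ (fderiv ℝ F x (F x)) (F x) / σ x (F x) with hμdef
  have hμ : ∀ x, x ≠ 0 → fderiv ℝ F x (F x) = μ x • x := fun x hx => by
    obtain ⟨m, hm⟩ := hplanar x hx
    have : μ x = m := by simp [hμdef, hm, (hpos x hx).ne']
    rw [this, hm]
  have hDF : ∀ x, x ≠ 0 → HasFDerivAt F (fderiv ℝ F x) x := fun x hx =>
    ((hF x hx).differentiableAt (by simp)).hasFDerivAt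
  have hD2 : ∀ x, x ≠ 0 → HasFDerivAt (fderiv ℝ F) (fderiv ℝ (fderiv ℝ F) x) x := fun x hx =>
    (((hF x hx).fderiv_right (m := 1) (by norm_cast)).differentiableAt
      (by simp)).hasFDerivAt
  have hnhds : ∀ x : E, x ≠ 0 → ∀ᶠ y in 𝓝 x, y ≠ 0 := fun x hx =>
    isOpen_ne.mem_nhds hx
  have hDapply : ∀ x, x ≠ 0 → ∀ v, HasFDerivAt (fun y => fderiv ℝ F y v)
      ((fderiv ℝ (fderiv ℝ F) x).flip v) x := fun x hx v => by
    simpa using (hD2 x hx).clm_apply (hasFDerivAt_const v x)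
  have hDFF : ∀ x, x ≠ 0 → HasFDerivAt (fun y => fderiv ℝ F y (F y))
      ((fderiv ℝ F x).comp (fderiv ℝ F x) + (fderiv ℝ (fderiv ℝ F) x).flip (F x)) x :=
    fun x hx => (hD2 x hx).clm_apply (hDF x hx)
  have hμd : ∀ x, x ≠ 0 → DifferentiableAt ℝ μ x := fun x hx => by
    have h1 := (hDFF x hx).differentiableAt
    have h2 := (hDF x hx).differentiableAt
    simp only [hμdef, div_eq_mul_inv]
    exact ((σ.differentiableAt.comp x h1).clm_apply h2).mul
      ((σ.differentiableAt.clm_apply h2).inv (hpos x hx).ne')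
  have hTs : ∀ x, x ≠ 0 → ∀ u v, fderiv ℝ (fderiv ℝ F) x u v = fderiv ℝ (fderiv ℝ F) x v u :=
    fun x hx => ((hF x hx).isSymmSndFDerivAt (by simp; norm_cast)).eq
  have hTσ : ∀ x, x ≠ 0 → ∀ w u v, σ u (fderiv ℝ (fderiv ℝ F) x w v)
      = σ v (fderiv ℝ (fderiv ℝ F) x w u) := by
    intro x hx w u v
    have h1 := (σ u).hasFDerivAt.comp x (hDapply x hx v)
    have h2 := (σ v).hasFDerivAt.comp x (hDapply x hx u)
    have h3 := h2.congr_of_eventuallyEq ((hnhds x hx).mono fun y hy => hsym y hy u v)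
    exact congrArg (fun L : E →L[ℝ] ℝ => L w) (h1.unique h3)
  have hE : ∀ x, x ≠ 0 → ∀ w, fderiv ℝ (fderiv ℝ F) x w (F x) + fderiv ℝ F x (fderiv ℝ F x w)
      = fderiv ℝ μ x w • x + μ x • w := by
    intro x hx w
    have h1 := (hμd x hx).hasFDerivAt.smul (hasFDerivAt_id x)
    have h2 := h1.congr_of_eventuallyEq ((hnhds x hx).mono fun y hy => hμ y hy)
    have := congrArg (fun L : E →L[ℝ] E => L w) ((hDFF x hx).unique h2)
    simp at this
    rw [add_comm, this, add_comm]
  have hA := fun x hx => comp_self_eq_of_derivative_identity hσ hnd (hpos x hx).ne'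
    (fderiv ℝ F x) (fun u v => fderiv ℝ (fderiv ℝ F) x u v) (fderiv ℝ μ x) (μ x) (heuler x hx)
    (hμ x hx) (hsym x hx) (hTσ x hx) (hTs x hx) (hE x hx)
  have hE2 : ∀ x, x ≠ 0 → ∀ w v, fderiv ℝ (fderiv ℝ F) x w (fderiv ℝ F x v)
      + fderiv ℝ F x (fderiv ℝ (fderiv ℝ F) x w v) = fderiv ℝ μ x w • v := by
    intro x hx w v
    have h0 := (hD2 x hx).clm_apply (hDapply x hx v)
    have h1 := (hμd x hx).hasFDerivAt.smul_const v
    have h2 := h1.congr_of_eventuallyEq ((hnhds x hx).mono fun y hy => (hA y hy).1 v)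
    have := congrArg (fun L : E →L[ℝ] E => L w) (h0.unique h2)
    simp at this
    rw [add_comm, this]
  have hμ0 : ∀ x, x ≠ 0 → fderiv ℝ μ x = 0 := by
    intro x hx
    obtain ⟨v, hv, hvx, hvy⟩ := hW x (F x)
    ext w
    exact factor_derivative_eq_zero hσ (hpos x hx).ne' (fderiv ℝ F x) (fderiv ℝ (fderiv ℝ F) x)
      (fderiv ℝ μ x) (μ x) (heuler x hx) (hsym x hx) (hTs x hx) (hE x hx) (hA x hx).1
      (hA x hx).2 (hE2 x hx) hv hvx hvy w
  have hFx : F x ≠ 0 := fun h => by simpa [h] using hpos x hx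
  have hconst : μ (F x) = μ x :=
    isOpen_compl_singleton.is_const_of_fderiv_eq_zero
      (isConnected_compl_singleton_of_one_lt_rank hrank 0).isPreconnected
      (fun y hy => (hμd y hy).differentiableWithinAt) (fun y hy => hμ0 y hy) hFx hx
  have hchain : ∀ v, fderiv ℝ F (F x) (fderiv ℝ F x v) = -v := by
    intro v
    have h1 := (hDF (F x) hFx).comp x (hDF x hx)
    have h2 := (hasFDerivAt_id (𝕜 := ℝ) x).neg.congr_of_eventuallyEq
      ((hnhds x hx).mono fun y hy => hinv y hy)
    exact congrArg (fun L : E →L[ℝ] E => L v) (h1.unique h2)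
  -- Evaluate the chain rule for `F ∘ F = -id` on `F x`, using planarity at `x` and at `F x` with
  -- the same factor.
  have hsq : μ x * μ x = 1 := by
    have h1 := hchain (F x)
    have h2 := hμ (F x) hFx
    rw [hinv x hx, map_neg, hconst] at h2
    rw [hμ x hx, map_smul, neg_eq_iff_eq_neg.1 h2, smul_neg, smul_smul, neg_inj] at h1
    have := congrArg (σ x) h1
    simp only [map_smul, smul_eq_mul] at this
    exact mul_right_cancel₀ (hpos x hx).ne' (by simpa using this)
  -- Monotonicity tested on `F x` gives `0 ≤ μ x * σ (F x) x`, and `σ (F x) x < 0`.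
  have hneg : μ x ≤ 0 := by
    have := hmono x hx (F x)
    rw [hμ x hx, map_smul, smul_eq_mul, alt] at this
    nlinarith [hpos x hx]
  have : μ x = -1 := by nlinarith
  rw [(hA x hx).1, this, neg_one_smul]

end LocalRigidity

/-! ### Global rigidity: a homogeneous field of tamed complex structures is constant. -/

section GlobalRigidity

variable {E K : Type*} [NormedAddCommGroup E] [NormedSpace ℝ E]
  [NormedAddCommGroup K] [InnerProductSpace ℂ K]

/-- The complex linear part (up to a factor) of a real linear map with respect to a complex
structure `D` on the source. -/
noncomputable def complexPart (q : E →L[ℝ] K) (D : E →L[ℝ] E) : E →L[ℝ] K :=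
  q - Complex.I • q.comp D

@[simp]
theorem complexPart_apply (q : E →L[ℝ] K) (D : E →L[ℝ] E) (v : E) :
    complexPart q D v = q v - Complex.I • q (D v) := rfl

theorem complexPart_comp (q : E →L[ℝ] K) {D : E →L[ℝ] E} (hD : ∀ v, D (D v) = -v) (v : E) :
    complexPart q D (D v) = Complex.I • complexPart q D v := by
  simp only [complexPart_apply, hD, map_neg, smul_sub, smul_smul, Complex.I_mul_I]
  module

/-- The moving vector whose complex part under `q` is the constant `e`, read off through `p`,
satisfies the Cauchy-Riemann equations. -/
theorem exists_hasFDerivAt_cauchyRiemann [CompleteSpace E] (q p : E →L[ℝ] K) (e : K)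
    {D : E → E →L[ℝ] E} {T : E →L[ℝ] E →L[ℝ] E} {x : E} (hT : HasFDerivAt D T x)
    (hTs : ∀ u v, T u v = T v u) (hD : ∀ᶠ y in 𝓝 x, ∀ v, D y (D y v) = -v)
    (hinv : ∀ᶠ y in 𝓝 x, (complexPart q (D y)).IsInvertible) :
    ∃ s' : E →L[ℝ] K,
      HasFDerivAt (fun y => complexPart p (D y) ((complexPart q (D y)).inverse e)) s' x ∧
      ∀ u, s' (D x u) = Complex.I • s' u := by
  have hLd : DifferentiableAt ℝ (fun y => complexPart q (D y)) x := by
    have h1 : DifferentiableAt ℝ (fun y => q.comp (D y)) x :=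
      (differentiableAt_const q).clm_comp hT.differentiableAt
    exact (differentiableAt_const q).sub (h1.const_smul Complex.I)
  set vec : E → E := fun y => (complexPart q (D y)).inverse e with hvec
  have hvd : DifferentiableAt ℝ vec x :=
    ((((hinv.self_of_nhds.contDiffAt_map_inverse (n := 1)).differentiableAt (by simp)).comp x
      hLd).clm_apply (differentiableAt_const e))
  set v' := fderiv ℝ vec x
  set v := vec x
  have hDv : HasFDerivAt (fun y => D y (vec y)) ((D x).comp v' + T.flip v) x :=
    hT.clm_apply hvd.hasFDerivAt
  have hder : ∀ r : E →L[ℝ] K, HasFDerivAt (fun y => complexPart r (D y) (vec y))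
      (r.comp v' - Complex.I • r.comp ((D x).comp v' + T.flip v)) x := by
    intro r
    have h1 := r.hasFDerivAt.comp x hvd.hasFDerivAt
    have h2 := r.hasFDerivAt.comp x hDv
    exact h1.sub (h2.const_smul Complex.I)
  have hDx := hD.self_of_nhds
  -- Derivative of `D² = -1`, with the symmetry of `T` used to move the direction of differentiation
  -- into the other slot.
  have hTD : ∀ u, T (D x u) v = -D x (T u v) := by
    intro u
    have hDu : HasFDerivAt (fun y => D y u) (T.flip u) x := by
      simpa using hT.clm_apply (hasFDerivAt_const u x)
    have h1 := hT.clm_apply hDu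
    have h2 : HasFDerivAt (fun _ : E => -u) (0 : E →L[ℝ] E) x := hasFDerivAt_const _ _
    have h3 := h2.congr_of_eventuallyEq (hD.mono fun y hy => hy u)
    have := congrArg (fun L : E →L[ℝ] E => L v) (h1.unique h3)
    simp at this
    rw [hTs, hTs u v, eq_neg_iff_add_eq_zero, add_comm, this]
  have hq0 : ∀ u, q (v' u) - Complex.I • q (D x (v' u) + T u v) = 0 := by
    intro u
    have h2 : HasFDerivAt (fun _ : E => e) (0 : E →L[ℝ] K) x := hasFDerivAt_const _ _
    have h3 := h2.congr_of_eventuallyEq (f₁ := fun y => complexPart q (D y) (vec y))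
      (hinv.mono fun y hy => (hy.inverse_apply_eq.1 rfl).symm)
    simpa using congrArg (fun L : E →L[ℝ] K => L u) ((hder q).unique h3)
  -- The Cauchy-Riemann defect read off through any `r` is the complex part of one vector that does
  -- not depend on `r`. For `q` the defect is zero because the function read off is the constant
  -- `e`; invertibility kills the vector, hence the defect for `p`.
  have alg : ∀ (r : E →L[ℝ] K) (u : E), complexPart r (D x) (v' (D x u) - D x (v' u) - T u v)
      = (r (v' (D x u)) - Complex.I • r (D x (v' (D x u)) + T (D x u) v))
        - Complex.I • (r (v' u) - Complex.I • r (D x (v' u) + T u v)) := by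
    intro r u
    simp only [complexPart_apply, map_sub, map_add, hDx, hTD, map_neg, smul_sub, smul_smul,
      Complex.I_mul_I, smul_add, smul_neg]
    module
  refine ⟨_, hder p, fun u => ?_⟩
  have hr : v' (D x u) - D x (v' u) - T u v = 0 := by
    have h1 := alg q u
    rw [hq0, hq0, smul_zero, sub_zero] at h1
    obtain ⟨f, hf⟩ := hinv.self_of_nhds
    rw [← hf] at h1
    exact (map_eq_zero_iff _ f.injective).1 h1
  have h1 := alg p u
  rw [hr, map_zero] at h1
  exact (sub_eq_zero.1 h1.symm)

theorem differentiableAt_complex_of_map_I_smul {f : K → K} {f' : K →L[ℝ] K} {z : K}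
    (h : HasFDerivAt f f' z) (hI : ∀ u, f' (Complex.I • u) = Complex.I • f' u) :
    DifferentiableAt ℂ f z := by
  rw [differentiableAt_iff_restrictScalars ℝ h.differentiableAt]
  refine ⟨⟨⟨⟨f', map_add f'⟩, fun c u => ?_⟩, f'.continuous⟩, ?_⟩
  · have h1 : ∀ w : K, c • w = c.re • w + c.im • (Complex.I • w) := fun w => by
      conv_lhs => rw [← Complex.re_add_im c]
      rw [add_smul, mul_smul, Complex.coe_smul, Complex.coe_smul]
    simp only [RingHom.id_apply]
    rw [h1 u, h1]
    simp [map_add, map_smul, hI]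
  · rw [h.fderiv]; rfl

/-- Maximum modulus principle in the coordinates given by a local diffeomorphism `Z`. -/
theorem eventually_eq_of_isLocalMax_norm_of_cauchyRiemann [CompleteSpace E] [CompleteSpace K]
    {Z s : E → K} {x₀ : E} {J : E → E →L[ℝ] E} {L : E → E →L[ℝ] K} (hZ : ContDiffAt ℝ 1 Z x₀)
    (hL : ∀ᶠ x in 𝓝 x₀, HasFDerivAt Z (L x) x) (hinv : ∀ᶠ x in 𝓝 x₀, (L x).IsInvertible)
    (hLJ : ∀ᶠ x in 𝓝 x₀, ∀ u, L x (J x u) = Complex.I • L x u)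
    (hs : ∀ᶠ x in 𝓝 x₀, ∃ s' : E →L[ℝ] K, HasFDerivAt s s' x ∧
      ∀ u, s' (J x u) = Complex.I • s' u)
    (hmax : IsLocalMax (norm ∘ s) x₀) : ∀ᶠ x in 𝓝 x₀, s x = s x₀ := by
  obtain ⟨f₀, hf₀⟩ := hinv.self_of_nhds
  have hL₀ : HasFDerivAt Z (f₀ : E →L[ℝ] K) x₀ := by rw [hf₀]; exact hL.self_of_nhds
  set e := hZ.toOpenPartialHomeomorph Z hL₀ one_ne_zero
  have hes : x₀ ∈ e.source := hZ.mem_toOpenPartialHomeomorph_source hL₀ one_ne_zero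
  have het : e x₀ ∈ e.target := e.map_source hes
  have hex : e.symm (e x₀) = x₀ := e.left_inv hes
  have hcont : Filter.Tendsto e.symm (𝓝 (e x₀)) (𝓝 x₀) := by
    have := e.symm.continuousAt het
    rwa [ContinuousAt, hex] at this
  have hdiff : ∀ᶠ z in 𝓝 (e x₀), DifferentiableAt ℂ (s ∘ e.symm) z := by
    filter_upwards [hcont.eventually hL, hcont.eventually hinv, hcont.eventually hLJ,
      hcont.eventually hs, e.open_target.mem_nhds het] with z h1 h2 h3 ⟨s', h4, h5⟩ hz
    obtain ⟨f, hf⟩ := h2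
    have hsymm : HasFDerivAt e.symm (f.symm : K →L[ℝ] E) z :=
      e.hasFDerivAt_symm hz (by rw [hf]; exact h1)
    refine differentiableAt_complex_of_map_I_smul (h4.comp z hsymm) fun u => ?_
    have h6 : f.symm (Complex.I • u) = J (e.symm z) (f.symm u) := by
      rw [f.symm_apply_eq]
      have := h3 (f.symm u)
      rw [← hf] at this
      simpa using this.symm
    simp [h6, h5]
  have hmax' : IsLocalMax (norm ∘ (s ∘ e.symm)) (e x₀) := by
    have := hcont.eventually hmax
    filter_upwards [this] with z hz
    simpa [hex] using hz
  -- Strict convexity upgrades constancy of the norm to constancy of the vector in the maximum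
  -- principle.
  have : StrictConvexSpace ℝ K := by
    let _ := InnerProductSpace.rclikeToReal ℂ K
    infer_instance
  have h := Complex.eventually_eq_of_isLocalMax_norm hdiff hmax'
  filter_upwards [(e.continuousAt hes).eventually h, e.open_source.mem_nhds hes] with x h1 h2
  simpa [e.left_inv h2, hex] using h1

/-- A positively homogeneous map whose derivatives are complex structures tamed by a fixed
bilinear form is linear away from the origin. -/
theorem fderiv_eq_of_comp_self_eq_neg [FiniteDimensional ℝ E] [FiniteDimensional ℂ K]
    {σ : E →L[ℝ] E →L[ℝ] ℝ} {F : E → E}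
    (hrank : 1 < Module.rank ℝ E)
    (hF : ∀ x, x ≠ 0 → ContDiffAt ℝ ∞ F x)
    (hhom : ∀ t : ℝ, 0 < t → ∀ x, x ≠ 0 → fderiv ℝ F (t • x) = fderiv ℝ F x)
    (hJ : ∀ x, x ≠ 0 → ∀ v, fderiv ℝ F x (fderiv ℝ F x v) = -v)
    (htame : ∀ x, x ≠ 0 → ∀ v, σ v (fderiv ℝ F x v) = 0 → v = 0)
    {q p : E →L[ℝ] K} (hfin : Module.finrank ℝ E = Module.finrank ℝ K)
    (hqσ : ∀ u v, q u = 0 → q v = 0 → σ u v = 0)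
    (hqreal : ∀ u v, q u = Complex.I • q v → q u = 0 ∧ q v = 0)
    (hpreal : ∀ u v, p u = Complex.I • p v → p u = 0 ∧ p v = 0)
    (hqp : ∀ u, q u = 0 → p u = 0 → u = 0) {x y : E} (hx : x ≠ 0) (hy : y ≠ 0) :
    fderiv ℝ F x = fderiv ℝ F y := by
  have : CompleteSpace E := FiniteDimensional.complete ℝ E
  have : CompleteSpace K := FiniteDimensional.complete ℂ K
  have : FiniteDimensional ℝ K := FiniteDimensional.complexToReal K
  set D := fderiv ℝ F with hDdef
  have hnhds : ∀ x : E, x ≠ 0 → ∀ᶠ y in 𝓝 x, y ≠ 0 := fun x hx => isOpen_ne.mem_nhds hx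
  have hinv : ∀ x, x ≠ 0 → (complexPart q (D x)).IsInvertible := by
    intro x hx
    -- A kernel vector `v` has both `v` and `D x v` in the isotropic subspace `ker q`, so taming
    -- gives `v = 0`.
    have hinj : Function.Injective (complexPart q (D x)) := by
      rw [injective_iff_map_eq_zero]
      intro v hv
      rw [complexPart_apply, sub_eq_zero] at hv
      obtain ⟨h1, h2⟩ := hqreal _ _ hv
      exact htame x hx v (hqσ _ _ h1 h2)
    have hsurj : Function.Surjective (complexPart q (D x)) :=
      (LinearMap.injective_iff_surjective_of_finrank_eq_finrank
        (f := (complexPart q (D x) : E →ₗ[ℝ] K)) hfin).1 hinj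
    exact ⟨ContinuousLinearEquiv.ofBijective (complexPart q (D x))
      (LinearMap.ker_eq_bot.2 hinj) (LinearMap.range_eq_top.2 hsurj),
      ContinuousLinearEquiv.coe_ofBijective _ _ _⟩
  have hDF : ∀ x, x ≠ 0 → HasFDerivAt F (D x) x := fun x hx =>
    ((hF x hx).differentiableAt (by simp)).hasFDerivAt
  have hD2 : ∀ x, x ≠ 0 → HasFDerivAt D (fderiv ℝ D x) x := fun x hx =>
    (((hF x hx).fderiv_right (m := 1) (by norm_cast)).differentiableAt (by simp)).hasFDerivAt
  have hTs : ∀ x, x ≠ 0 → ∀ u v, fderiv ℝ D x u v = fderiv ℝ D x v u :=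
    fun x hx => ((hF x hx).isSymmSndFDerivAt (by simp; norm_cast)).eq
  have hZ : ∀ x, x ≠ 0 → ContDiffAt ℝ 1 (fun x => q x - Complex.I • q (F x)) x := by
    intro x hx
    have h1 : ContDiffAt ℝ 1 F x := (hF x hx).of_le (by norm_cast)
    have h2 : ContDiffAt ℝ 1 (fun x => q (F x)) x := q.contDiff.contDiffAt.comp x h1
    exact q.contDiff.contDiffAt.sub (contDiffAt_const.smul h2)
  have hZ' : ∀ x, x ≠ 0 →
      HasFDerivAt (fun x => q x - Complex.I • q (F x)) (complexPart q (D x)) x := fun x hx =>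
    q.hasFDerivAt.sub ((q.hasFDerivAt.comp x (hDF x hx)).const_smul Complex.I)
  have hCR : ∀ e x, x ≠ 0 → ∃ s' : E →L[ℝ] K,
      HasFDerivAt (fun y => complexPart p (D y) ((complexPart q (D y)).inverse e)) s' x ∧
      ∀ u, s' (D x u) = Complex.I • s' u := fun e x hx =>
    exists_hasFDerivAt_cauchyRiemann q p e (hD2 x hx) (hTs x hx)
      ((hnhds x hx).mono hJ) ((hnhds x hx).mono hinv)
  have hconst : ∀ e x, x ≠ 0 → ∀ y, y ≠ 0 →
      complexPart p (D x) ((complexPart q (D x)).inverse e)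
        = complexPart p (D y) ((complexPart q (D y)).inverse e) := by
    intro e
    set s : E → K := fun y => complexPart p (D y) ((complexPart q (D y)).inverse e) with hs
    have hsc : ∀ x, x ≠ 0 → ContinuousAt s x := fun x hx =>
      let ⟨_, h, _⟩ := hCR e x hx
      h.continuousAt
    have : Nontrivial E := ⟨x, 0, hx⟩
    obtain ⟨x₀, hx₀, hmax⟩ := (isCompact_sphere (0 : E) 1).exists_isMaxOn
      (NormedSpace.sphere_nonempty.2 zero_le_one) (f := norm ∘ s)
      (fun x hx => (hsc x (ne_zero_of_mem_unit_sphere ⟨x, hx⟩)).norm.continuousWithinAt)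
    have hx₀0 : x₀ ≠ 0 := ne_zero_of_mem_unit_sphere ⟨x₀, hx₀⟩
    -- By 0-homogeneity the maximum over the compact sphere is global, so every point where `s`
    -- takes the value `s x₀` is a local maximum of the norm. This makes the level set of `s x₀`
    -- open.
    have hglob : ∀ x, x ≠ 0 → ‖s x‖ ≤ ‖s x₀‖ := by
      intro x hx
      have h1 : s (‖x‖⁻¹ • x) = s x := by
        simp only [hs, hhom _ (inv_pos.2 (norm_pos_iff.2 hx)) x hx]
      rw [← h1]
      exact hmax (by simp [norm_smul, hx])
    have hsub : ({0}ᶜ : Set E) ⊆ {x | x ≠ 0 ∧ s x = s x₀} := by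
      refine (isConnected_compl_singleton_of_one_lt_rank hrank 0).isPreconnected
        |>.subset_of_closure_inter_subset ?_ ⟨x₀, hx₀0, hx₀0, rfl⟩ ?_
      · rw [isOpen_iff_mem_nhds]
        rintro x ⟨hx, hsx⟩
        have hloc : IsLocalMax (norm ∘ s) x :=
          (hnhds x hx).mono fun y hy => by
            simpa [hsx] using hglob y hy
        have := eventually_eq_of_isLocalMax_norm_of_cauchyRiemann (hZ x hx)
          ((hnhds x hx).mono hZ') ((hnhds x hx).mono hinv)
          ((hnhds x hx).mono fun y hy => complexPart_comp q (hJ y hy))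
          ((hnhds x hx).mono (hCR e)) hloc
        filter_upwards [this, hnhds x hx] with y h1 h2
        exact ⟨h2, h1.trans hsx⟩
      · rintro x ⟨hxc, hx⟩
        refine ⟨hx, ?_⟩
        have := (hsc x hx).continuousWithinAt.mem_closure hxc
          (t := {s x₀}) (fun y hy => hy.2)
        simpa using this
    intro x hx y hy
    exact (hsub hx).2.trans (hsub hy).2.symm
  ext v
  -- the graphs of the two complex structures have the same `i`-eigenspace
  set u := (complexPart q (D y)).inverse (complexPart q (D x) v) with hu
  have h1 : complexPart q (D y) u = complexPart q (D x) v :=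
    ((hinv y hy).inverse_apply_eq.1 rfl).symm
  have h2 : complexPart p (D y) u = complexPart p (D x) v := by
    rw [hu, ← hconst _ x hx y hy]
    congr 1
    exact (hinv x hx).inverse_apply_eq.2 rfl
  -- The range of `r` is totally real, so equality of complex parts splits into equality of `r` on
  -- the vectors and on their images under `D`.
  have real : ∀ r : E →L[ℝ] K, (∀ u v, r u = Complex.I • r v → r u = 0 ∧ r v = 0) →
      complexPart r (D y) u = complexPart r (D x) v →
      r (u - v) = 0 ∧ r (D y u - D x v) = 0 := by
    intro r hr h
    apply hr
    simp only [complexPart_apply] at h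
    simp only [map_sub, smul_sub]
    have h' := sub_eq_zero.2 h
    rw [← sub_eq_zero, ← h']
    abel
  obtain ⟨a1, a2⟩ := real q hqreal h1
  obtain ⟨b1, b2⟩ := real p hpreal h2
  have huv : u = v := sub_eq_zero.1 (hqp _ a1 b1)
  have := sub_eq_zero.1 (hqp _ a2 b2)
  rw [huv] at this
  exact this.symm

end GlobalRigidity

/-! ### Unitary bases for a compatible complex structure. -/

section SymplecticLinearAlgebra

variable {n : ℕ}

/-- The standard symplectic form as a continuous bilinear map. -/
noncomputable def sympFormL (n : ℕ) : SympSpace n →L[ℝ] SympSpace n →L[ℝ] ℝ :=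
  (LinearMap.mk₂ ℝ (sympForm (n := n)) sympForm_add_left sympForm_smul_left
    (fun x y y' => by
      simp only [sympForm, PiLp.add_apply, ← Finset.sum_add_distrib]
      exact Finset.sum_congr rfl fun i _ => by ring)
    sympForm_smul_right).toContinuousBilinearMap

@[simp]
theorem sympFormL_apply (x y : SympSpace n) : sympFormL n x y = sympForm x y := rfl

theorem sympForm_self (x : SympSpace n) : sympForm x x = 0 := by
  simp [sympForm, mul_comm]

theorem sympForm_neg_swap (x y : SympSpace n) : sympForm x y = -sympForm y x :=
  alternating_neg (σ := sympFormL n) sympForm_self x y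

theorem sympForm_nondegenerate (y : SympSpace n) (h : ∀ v, sympForm v y = 0) : y = 0 :=
  sympForm_ext fun v => by rw [h, ← sympFormL_apply, map_zero]

/-- The Lagrangian subspace of vectors with vanishing position. -/
noncomputable def momentumInclusion (n : ℕ) : (Fin n → ℝ) →ₗ[ℝ] SympSpace n where
  toFun u := WithLp.toLp 2 (Sum.elim (fun _ => 0) u)
  map_add' u v := by ext (i | i) <;> simp
  map_smul' c u := by ext (i | i) <;> simp

theorem sympForm_momentumInclusion (u v : Fin n → ℝ) :
    sympForm (momentumInclusion n u) (momentumInclusion n v) = 0 := by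
  simp [sympForm, momentumInclusion]

theorem momentumInclusion_injective : Function.Injective (momentumInclusion n) := by
  intro u v h
  ext i
  simpa [momentumInclusion] using congrArg (fun x : SympSpace n => x (Sum.inr i)) h

/-- Diagonalise the inner product `ω(·, J ·)` on the Lagrangian momentum space and normalise;
isotropy of that space gives the first relation. -/
theorem exists_orthonormal_momentum {J : SympSpace n →L[ℝ] SympSpace n}
    (hsym : ∀ u v, sympForm u (J v) = sympForm v (J u))
    (hpos : ∀ v, v ≠ 0 → 0 < sympForm v (J v)) :
    ∃ e : Fin n → SympSpace n, (∀ i j, sympForm (e i) (e j) = 0) ∧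
      ∀ i j, sympForm (e i) (J (e j)) = if i = j then 1 else 0 := by
  set B : LinearMap.BilinForm ℝ (Fin n → ℝ) :=
    LinearMap.mk₂ ℝ (fun u v => sympFormL n (momentumInclusion n u) (J (momentumInclusion n v)))
      (fun _ _ _ => by simp only [map_add, FunLike.coe_add, Pi.add_apply])
      (fun _ _ _ => by simp only [map_smul, FunLike.coe_smul, Pi.smul_apply])
      (fun _ _ _ => by simp only [map_add])
      (fun _ _ _ => by simp only [map_smul]) with hB
  obtain ⟨b', hb'⟩ := LinearMap.BilinForm.exists_orthogonal_basis (B := B) ⟨fun u v => hsym _ _⟩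
  set b := b'.reindex (finCongr (Module.finrank_fin_fun ℝ)) with hb
  have hbo : ∀ i j, i ≠ j → B (b i) (b j) = 0 := by
    intro i j hij
    simp only [hb, Module.Basis.reindex_apply]
    exact hb' (by simpa using hij)
  have hbp : ∀ i, 0 < B (b i) (b i) := fun i =>
    hpos _ ((map_ne_zero_iff _ momentumInclusion_injective).2 (b.ne_zero i))
  refine ⟨fun i => (√(B (b i) (b i)))⁻¹ • momentumInclusion n (b i), fun i j => ?_, fun i j => ?_⟩
  · rw [sympForm_smul_left, sympForm_smul_right, sympForm_momentumInclusion]; simp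
  · have h1 : sympForm (momentumInclusion n (b i)) (J (momentumInclusion n (b j)))
        = B (b i) (b j) := rfl
    rw [map_smul, sympForm_smul_left, sympForm_smul_right, h1]
    split_ifs with hij
    · subst hij
      have h2 := Real.mul_self_sqrt (hbp i).le
      have h3 := (Real.sqrt_pos.2 (hbp i)).ne'
      field_simp
      linarith
    · rw [hbo i j hij]; simp

/-- An orthonormal basis `e` of a Lagrangian subspace, completed by `J e`, is at once a Darboux
basis for `ω` and an orthonormal basis for `ω(·, J ·)`. `Φ` is the inverse of the map `Ψ` sending
the standard basis to it. -/
theorem exists_symplectic_orthonormal {J : SympSpace n →L[ℝ] SympSpace n}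
    (hJ : ∀ v, J (J v) = -v) (hsym : ∀ u v, sympForm u (J v) = sympForm v (J u))
    (hpos : ∀ v, v ≠ 0 → 0 < sympForm v (J v)) :
    ∃ Φ : SympSpace n ≃ₗ[ℝ] SympSpace n, (∀ x y, sympForm (Φ x) (Φ y) = sympForm x y) ∧
      ∀ x, ‖Φ x‖ ^ 2 = sympForm x (J x) := by
  obtain ⟨e, he, heJ⟩ := exists_orthonormal_momentum hsym hpos
  have heJ' : ∀ i j, sympForm (J (e i)) (e j) = if i = j then -1 else 0 := fun i j => by
    rw [sympForm_neg_swap, heJ]; split_ifs with h1 h2 h2 <;> simp_all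
  have hJJ : ∀ i j, sympForm (J (e i)) (J (e j)) = 0 := fun i j => by
    rw [hsym, hJ, ← sympFormL_apply, map_neg, sympFormL_apply, he, neg_zero]
  set Ψ : SympSpace n →ₗ[ℝ] SympSpace n :=
    ∑ i : Fin n, ((LinearMap.toSpanSingleton ℝ _ (e i)).comp
        (EuclideanSpace.proj (𝕜 := ℝ) (Sum.inl i : Fin n ⊕ Fin n)).toLinearMap
      + (LinearMap.toSpanSingleton ℝ _ (J (e i))).comp
        (EuclideanSpace.proj (𝕜 := ℝ) (Sum.inr i : Fin n ⊕ Fin n)).toLinearMap) with hΨdef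
  have hΨ : ∀ x, Ψ x = ∑ i, (x (Sum.inl i) • e i + x (Sum.inr i) • J (e i)) := fun x => by
    simp [hΨdef]
  have hΨω : ∀ x y, sympForm (Ψ x) (Ψ y) = sympForm x y := by
    intro x y
    rw [← sympFormL_apply, hΨ, hΨ]
    simp only [map_sum, map_add, map_smul, FunLike.coe_add, FunLike.coe_smul,
      FunLike.coe_sum, Finset.sum_apply, Pi.add_apply, Pi.smul_apply,
      smul_eq_mul, sympFormL_apply, he, heJ, heJ', hJJ]
    simp [sympForm, mul_ite, -Finset.sum_sub_distrib]
    exact Finset.sum_congr rfl fun i _ => by ring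
  have hΨn : ∀ x, sympForm (Ψ x) (J (Ψ x)) = ‖x‖ ^ 2 := by
    intro x
    rw [← sympFormL_apply, hΨ]
    simp only [map_sum, map_add, map_smul, FunLike.coe_add, FunLike.coe_smul,
      FunLike.coe_sum, Finset.sum_apply, Pi.add_apply, Pi.smul_apply, hJ, map_neg,
      smul_eq_mul, sympFormL_apply, he, heJ, heJ', hJJ]
    simp [EuclideanSpace.norm_sq_eq, mul_ite, ← Finset.sum_add_distrib]
    exact Finset.sum_congr rfl fun i _ => by ring
  have hinj : Function.Injective Ψ := by
    rw [injective_iff_map_eq_zero]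
    intro x hx
    have := hΨn x
    rw [hx, map_zero, ← sympFormL_apply, map_zero] at this
    simpa using this.symm
  refine ⟨(LinearEquiv.ofInjectiveEndo Ψ hinj).symm, fun x y => ?_, fun x => ?_⟩
  · rw [← hΨω]
    congr 1 <;> exact (LinearEquiv.ofInjectiveEndo Ψ hinj).apply_symm_apply _
  · rw [← hΨn]
    have : Ψ ((LinearEquiv.ofInjectiveEndo Ψ hinj).symm x) = x :=
      (LinearEquiv.ofInjectiveEndo Ψ hinj).apply_symm_apply _
    rw [this]

end SymplecticLinearAlgebra

/-! ### Smoothness and homogeneity of the gauge. -/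

section Gauge

variable {n : ℕ}

theorem HasSmoothBoundary.of_le {k m : WithTop ℕ∞} {X : Set (SympSpace n)}
    (h : HasSmoothBoundary m X) (hk : k ≤ m) : HasSmoothBoundary k X := fun x hx =>
  let ⟨ρ, U, hU, hxU, hρ, h⟩ := h x hx
  ⟨ρ, U, hU, hxU, hρ.of_le hk, h⟩

theorem IsDefiningFunctionAt.of_le {k m : WithTop ℕ∞} {X : Set (SympSpace n)} {x : SympSpace n}
    {ρ : SympSpace n → ℝ} (h : IsDefiningFunctionAt m X x ρ) (hk : k ≤ m) :
    IsDefiningFunctionAt k X x ρ :=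
  let ⟨U, hU, hxU, hρ, h⟩ := h
  ⟨U, hU, hxU, hρ.of_le hk, h⟩

theorem IsDefiningFunctionAt.eq_zero {X : Set (SympSpace n)} {x : SympSpace n}
    {ρ : SympSpace n → ℝ} (h : IsDefiningFunctionAt 1 X x ρ) (hX : IsClosed X)
    (hx : x ∈ frontier X) : ρ x = 0 := by
  obtain ⟨U, hU, hxU, hρ, hXU, -⟩ := h
  refine le_antisymm ((hXU x hxU).1 (hX.frontier_subset hx)) (not_lt.1 fun hlt => hx.2 ?_)
  rw [mem_interior_iff_mem_nhds]
  filter_upwards [hU.mem_nhds hxU,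
    (hρ.continuousOn.continuousAt (hU.mem_nhds hxU)).eventually (gt_mem_nhds hlt)] with a ha ha'
  exact (hXU a ha).2 ha'.le

/-- A functional supporting `X` at `x` vanishes on the tangent space at `x`. -/
theorem IsDefiningFunctionAt.supporting_eq_zero {X : Set (SympSpace n)} {x : SympSpace n}
    {ρ : SympSpace n → ℝ} (h : IsDefiningFunctionAt 1 X x ρ) (hX : IsClosed X)
    (hx : x ∈ frontier X) {l : SympSpace n →L[ℝ] ℝ} (hl : ∀ y ∈ X, l y ≤ 1) (hlx : l x = 1)
    {w : SympSpace n} (hw : fderiv ℝ ρ x w = 0) : l w = 0 := by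
  have hρ0 := h.eq_zero hX hx
  obtain ⟨U, hU, hxU, hρ, hXU, hne⟩ := h
  have hd : HasFDerivAt ρ (fderiv ℝ ρ x) x :=
    ((hρ.contDiffAt (hU.mem_nhds hxU)).differentiableAt (by norm_num)).hasFDerivAt
  obtain ⟨v₀, hv₀⟩ : ∃ v, fderiv ℝ ρ x v < 0 := by
    obtain ⟨v, hv⟩ : ∃ v, fderiv ℝ ρ x v ≠ 0 := by
      by_contra! h
      exact hne (ContinuousLinearMap.ext h)
    rcases lt_or_gt_of_ne hv with h | h
    · exact ⟨v, h⟩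
    · exact ⟨-v, by simpa using h⟩
  have hneg : ∀ v, fderiv ℝ ρ x v < 0 → l v ≤ 0 := by
    intro v hv
    have hline : HasDerivAt (fun t : ℝ => x + t • v) v 0 := by
      simpa using ((hasDerivAt_id (0 : ℝ)).smul_const v).const_add x
    have hcomp : HasDerivAt (fun t : ℝ => ρ (x + t • v)) (fderiv ℝ ρ x v) 0 := by
      have hd' : HasFDerivAt ρ (fderiv ℝ ρ x) (x + (0 : ℝ) • v) := by simpa using hd
      exact hd'.comp_hasDerivAt 0 hline
    have hev := hcomp.tendsto_slope_zero_right.eventually (gt_mem_nhds hv)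
    have hUev : ∀ᶠ t : ℝ in 𝓝[>] 0, x + t • v ∈ U := by
      have : Filter.Tendsto (fun t : ℝ => x + t • v) (𝓝[>] 0) (𝓝 x) := by
        simpa using hline.continuousAt.tendsto.mono_left nhdsWithin_le_nhds
      exact this.eventually (hU.mem_nhds hxU)
    obtain ⟨t, ⟨ht1, ht2⟩, ht3⟩ := ((hev.and hUev).and self_mem_nhdsWithin).exists
    have htpos : (0 : ℝ) < t := ht3
    have hρt : ρ (x + t • v) < 0 := by
      simp only [zero_add, zero_smul, add_zero, hρ0, sub_zero, smul_eq_mul] at ht1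
      by_contra! hcon
      exact absurd ht1 (not_lt.2 (mul_nonneg (inv_nonneg.2 htpos.le) hcon))
    have h1 := hl _ ((hXU _ ht2).2 hρt.le)
    rw [map_add, map_smul, hlx, smul_eq_mul] at h1
    exact nonpos_of_mul_nonpos_right (by linarith : t * l v ≤ 0) htpos
  by_contra hne'
  -- Adding a multiple of `w` leaves the derivative of `ρ` negative, while this coefficient makes
  -- `l` equal to `1`.
  have h1 := hneg (v₀ + ((1 - l v₀) / l w) • w) (by simpa [hw] using hv₀)
  rw [map_add, map_smul, smul_eq_mul, div_mul_cancel₀ _ hne'] at h1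
  linarith

theorem IsDefiningFunctionAt.fderiv_self_ne_zero {X : ConvexBody (SympSpace n)}
    (h0 : (0 : SympSpace n) ∈ interior (X : Set (SympSpace n)))
    (hX : HasSmoothBoundary 1 (X : Set (SympSpace n))) {x : SympSpace n}
    {ρ : SympSpace n → ℝ} (h : IsDefiningFunctionAt 1 (X : Set (SympSpace n)) x ρ)
    (hx : x ∈ frontier (X : Set (SympSpace n))) : fderiv ℝ ρ x x ≠ 0 := by
  obtain ⟨y, ⟨hy, hxy⟩, -⟩ := existsUnique_polarityMap X h0 hX hx
  intro hcon
  have := h.supporting_eq_zero X.isClosed hx (l := (sympFormL n).flip y)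
    ((isClosed_symplecticPolar _).frontier_subset hy) hxy hcon
  rw [ContinuousLinearMap.flip_apply, sympFormL_apply, hxy] at this
  exact one_ne_zero this

/-- Near `x` the gauge is `1 / τ`, where `τ u` solves `ρ (τ u • u) = 0`. The implicit function
theorem applies because the radial derivative of `ρ` at `x` is nonzero, a supporting functional
being nonzero on `x`. -/
theorem gauge_contDiffAt_of_mem_frontier {X : ConvexBody (SympSpace n)}
    (h0 : (0 : SympSpace n) ∈ interior (X : Set (SympSpace n)))
    (hX : HasSmoothBoundary ∞ (X : Set (SympSpace n))) {x : SympSpace n}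
    (hx : x ∈ frontier (X : Set (SympSpace n))) :
    ContDiffAt ℝ ∞ (gauge (X : Set (SympSpace n))) x := by
  have h0' : (X : Set (SympSpace n)) ∈ 𝓝 0 := mem_interior_iff_mem_nhds.1 h0
  have h1le : (1 : WithTop ℕ∞) ≤ ∞ := by norm_cast
  obtain ⟨ρ, hρd⟩ := hX x hx
  have hρ0 := (hρd.of_le h1le).eq_zero X.isClosed hx
  have hρx := (hρd.of_le h1le).fderiv_self_ne_zero h0 (hX.of_le h1le) hx
  obtain ⟨U, hU, hxU, hρ, hXU, hne⟩ := hρd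
  have hρC : ContDiffAt ℝ ∞ ρ x := hρ.contDiffAt (hU.mem_nhds hxU)
  have hd : HasFDerivAt ρ (fderiv ℝ ρ x) x := (hρC.differentiableAt (by simp)).hasFDerivAt
  set f : SympSpace n × ℝ → ℝ := fun z => ρ (z.2 • z.1) with hf
  have hm : ContDiff ℝ ∞ (fun z : SympSpace n × ℝ => z.2 • z.1) := contDiff_snd.smul contDiff_fst
  have hfC : ContDiffAt ℝ ∞ f (x, 1) :=
    ContDiffAt.comp (x, (1 : ℝ)) (g := ρ) (by simpa using hρC) hm.contDiffAt
  have hpart : ∀ s : ℝ, fderiv ℝ f (x, 1) (0, s) = s * fderiv ℝ ρ x x := by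
    intro s
    have hd' : HasFDerivAt ρ (fderiv ℝ ρ x) ((1 : ℝ) • x) := by simpa using hd
    have hsmul := (hasFDerivAt_snd (𝕜 := ℝ) (p := (x, (1 : ℝ)))).fun_smul hasFDerivAt_fst
    have h1 := HasFDerivAt.comp (x, (1 : ℝ)) hd' hsmul
    change HasFDerivAt f _ _ at h1
    rw [h1.fderiv]
    simp
  have hinv : (fderiv ℝ f (x, 1) ∘L .inr ℝ (SympSpace n) ℝ).IsInvertible := by
    refine ⟨ContinuousLinearEquiv.unitsEquivAut ℝ (Units.mk0 _ hρx), ?_⟩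
    ext
    simp [hpart]
  have hn : (∞ : WithTop ℕ∞) ≠ 0 := by simp
  set τ := hfC.implicitFunction hn hinv with hτ
  have hτ1 : τ x = 1 := hfC.implicitFunction_apply_self hn hinv
  have hτC : ContDiffAt ℝ ∞ τ x := hfC.contDiffAt_implicitFunction hn hinv
  have hτe : ∀ᶠ u in 𝓝 x, ρ (τ u • u) = 0 := by
    simpa [hf, hρ0] using hfC.eventually_apply_implicitFunction hn hinv
  have htend : Filter.Tendsto (fun u => τ u • u) (𝓝 x) (𝓝 x) := by
    have : ContinuousAt (fun u => τ u • u) x := hτC.continuousAt.smul continuousAt_id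
    simpa [ContinuousAt, hτ1] using this
  have hfd : ∀ᶠ y in 𝓝 x, fderiv ℝ ρ y ≠ 0 :=
    ((hρC.fderiv_right (m := 0) (by norm_cast)).continuousAt).eventually_ne hne
  have hpos : ∀ᶠ u in 𝓝 x, 0 < τ u :=
    hτC.continuousAt.eventually (lt_mem_nhds (by rw [hτ1]; exact one_pos))
  have heq : ∀ᶠ u in 𝓝 x, gauge (X : Set (SympSpace n)) u = (τ u)⁻¹ := by
    filter_upwards [hτe, htend.eventually hfd, htend.eventually (hU.mem_nhds hxU), hpos]
      with u h1 h2 h3 h4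
    -- At an interior point of `X` with `ρ = 0`, `ρ` would have a local maximum, against its nonzero
    -- differential.
    have hfr : τ u • u ∈ frontier (X : Set (SympSpace n)) := by
      refine ⟨subset_closure ((hXU _ h3).2 h1.le), fun hint => h2 ?_⟩
      apply IsLocalMax.fderiv_eq_zero
      filter_upwards [hU.mem_nhds h3, mem_interior_iff_mem_nhds.1 hint] with y hy1 hy2
      rw [h1]
      exact (hXU y hy1).1 hy2
    have h5 := (gauge_eq_one_iff_mem_frontier X.convex h0').2 hfr
    rw [gauge_smul_of_nonneg h4.le, smul_eq_mul] at h5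
    exact eq_inv_of_mul_eq_one_right h5
  exact (hτC.inv (by rw [hτ1]; exact one_ne_zero)).congr_of_eventuallyEq heq

theorem gauge_pos_of_ne_zero {X : ConvexBody (SympSpace n)}
    (h0 : (0 : SympSpace n) ∈ interior (X : Set (SympSpace n))) {x : SympSpace n} (hx : x ≠ 0) :
    0 < gauge (X : Set (SympSpace n)) x :=
  (gauge_pos (absorbent_nhds_zero (mem_interior_iff_mem_nhds.1 h0))
    ((NormedSpace.isVonNBounded_iff ℝ).2 X.isCompact.isBounded)).2 hx

theorem normalize_mem_frontier {X : ConvexBody (SympSpace n)}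
    (h0 : (0 : SympSpace n) ∈ interior (X : Set (SympSpace n))) {x : SympSpace n} (hx : x ≠ 0) :
    (gauge (X : Set (SympSpace n)) x)⁻¹ • x ∈ frontier (X : Set (SympSpace n)) := by
  have hg := gauge_pos_of_ne_zero h0 hx
  rw [← gauge_eq_one_iff_mem_frontier X.convex (mem_interior_iff_mem_nhds.1 h0),
    gauge_smul_of_nonneg (inv_nonneg.2 hg.le), smul_eq_mul, inv_mul_cancel₀ hg.ne']

theorem ne_zero_of_mem_frontier {X : Set (SympSpace n)}
    (h0 : (0 : SympSpace n) ∈ interior X) {x : SympSpace n} (hx : x ∈ frontier X) : x ≠ 0 := by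
  rintro rfl
  exact hx.2 h0

theorem gauge_contDiffAt {X : ConvexBody (SympSpace n)}
    (h0 : (0 : SympSpace n) ∈ interior (X : Set (SympSpace n)))
    (hX : HasSmoothBoundary ∞ (X : Set (SympSpace n))) {x : SympSpace n} (hx : x ≠ 0) :
    ContDiffAt ℝ ∞ (gauge (X : Set (SympSpace n))) x := by
  set c := (gauge (X : Set (SympSpace n)) x)⁻¹
  have hc : 0 < c := inv_pos.2 (gauge_pos_of_ne_zero h0 hx)
  have h1 := gauge_contDiffAt_of_mem_frontier h0 hX (normalize_mem_frontier h0 hx)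
  have h2 : ContDiffAt ℝ ∞ (fun u => c⁻¹ * gauge (X : Set (SympSpace n)) (c • u)) x :=
    contDiffAt_const.mul (h1.comp x (contDiff_const_smul c).contDiffAt)
  convert! h2 using 2 with u
  rw [gauge_smul_of_nonneg hc.le, smul_eq_mul, inv_mul_cancel_left₀ hc.ne']

theorem mem_iff_gauge_le_one {X : ConvexBody (SympSpace n)}
    (h0 : (0 : SympSpace n) ∈ interior (X : Set (SympSpace n))) {x : SympSpace n} :
    x ∈ (X : Set (SympSpace n)) ↔ gauge (X : Set (SympSpace n)) x ≤ 1 := by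
  rw [gauge_le_one_iff_mem_closure X.convex (mem_interior_iff_mem_nhds.1 h0),
    X.isClosed.closure_eq]

theorem fderiv_gauge_le {X : ConvexBody (SympSpace n)}
    (h0 : (0 : SympSpace n) ∈ interior (X : Set (SympSpace n)))
    (hX : HasSmoothBoundary ∞ (X : Set (SympSpace n))) {x : SympSpace n} (hx : x ≠ 0)
    (v : SympSpace n) :
    fderiv ℝ (gauge (X : Set (SympSpace n))) x v ≤ gauge (X : Set (SympSpace n)) v := by
  have hd := ((gauge_contDiffAt h0 hX hx).differentiableAt (by simp)).hasFDerivAt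
  have hline : HasDerivAt (fun t : ℝ => x + t • v) v 0 := by
    simpa using ((hasDerivAt_id (0 : ℝ)).smul_const v).const_add x
  have hcomp : HasDerivAt (fun t : ℝ => gauge (X : Set (SympSpace n)) (x + t • v))
      (fderiv ℝ (gauge (X : Set (SympSpace n))) x v) 0 :=
    HasFDerivAt.comp_hasDerivAt (l := gauge (X : Set (SympSpace n))) 0 (by simpa using hd) hline
  refine le_of_tendsto hcomp.tendsto_slope_zero_right ?_
  filter_upwards [self_mem_nhdsWithin] with t ht
  have ht' : (0 : ℝ) < t := ht
  have := gauge_add_le X.convex (absorbent_nhds_zero (mem_interior_iff_mem_nhds.1 h0)) x (t • v)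
  rw [gauge_smul_of_nonneg ht'.le, smul_eq_mul] at this
  simp only [zero_add, zero_smul, add_zero, smul_eq_mul]
  rw [inv_mul_le_iff₀ ht']
  linarith

theorem fderiv_gauge_smul {X : Set (SympSpace n)} {t : ℝ} (ht : 0 < t) (x : SympSpace n) :
    fderiv ℝ (gauge X) (t • x) = fderiv ℝ (gauge X) x := by
  have h1 : gauge X = t⁻¹ • fun u => gauge X (t • u) := by
    ext u
    rw [Pi.smul_apply, gauge_smul_of_nonneg ht.le, smul_eq_mul, smul_eq_mul,
      inv_mul_cancel_left₀ ht.ne']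
  conv_rhs => rw [h1]
  rw [fderiv_const_smul_field, Pi.smul_apply, fderiv_comp_smul, smul_smul, inv_mul_cancel₀
      ht.ne', one_smul]

theorem fderiv_gauge_self {X : ConvexBody (SympSpace n)}
    (h0 : (0 : SympSpace n) ∈ interior (X : Set (SympSpace n)))
    (hX : HasSmoothBoundary ∞ (X : Set (SympSpace n))) {x : SympSpace n} (hx : x ≠ 0) :
    fderiv ℝ (gauge (X : Set (SympSpace n))) x x = gauge (X : Set (SympSpace n)) x := by
  have hd := ((gauge_contDiffAt h0 hX hx).differentiableAt (by simp)).hasFDerivAt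
  have hline : HasDerivAt (fun t : ℝ => t • x) x 1 := by
    simpa using (hasDerivAt_id (1 : ℝ)).smul_const x
  have hcomp : HasDerivAt (fun t : ℝ => gauge (X : Set (SympSpace n)) (t • x))
      (fderiv ℝ (gauge (X : Set (SympSpace n))) x x) 1 :=
    HasFDerivAt.comp_hasDerivAt (l := gauge (X : Set (SympSpace n))) 1 (by simpa using hd) hline
  have h2 : HasDerivAt (fun t : ℝ => t * gauge (X : Set (SympSpace n)) x)
      (gauge (X : Set (SympSpace n)) x) 1 := by
    simpa using (hasDerivAt_id (1 : ℝ)).mul_const (gauge (X : Set (SympSpace n)) x)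
  refine hcomp.unique (h2.congr_of_eventuallyEq ?_)
  filter_upwards [lt_mem_nhds (zero_lt_one (α := ℝ))] with t ht
  rw [gauge_smul_of_nonneg ht.le, smul_eq_mul]

end Gauge

/-! ### The Hamiltonian field, the polarity map and the characteristics. -/

section HamiltonianField

variable {n : ℕ}

/-- The identification of covectors with vectors by the symplectic form. -/
noncomputable def sympDual (n : ℕ) : SympSpace n ≃L[ℝ] (SympSpace n →L[ℝ] ℝ) :=
  ContinuousLinearEquiv.ofBijective (sympFormL n).flip
    (LinearMap.ker_eq_bot.2 fun _ _ h => sympForm_ext fun v =>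
      congrArg (fun l : SympSpace n →L[ℝ] ℝ => l v) h)
    (LinearMap.range_eq_top.2 fun g =>
      let ⟨y, hy⟩ := exists_sympForm_eq g
      ⟨y, ContinuousLinearMap.ext hy⟩)

theorem sympForm_sympDual_symm (g : SympSpace n →L[ℝ] ℝ) (v : SympSpace n) :
    sympForm v ((sympDual n).symm g) = g v :=
  congrArg (fun l : SympSpace n →L[ℝ] ℝ => l v) ((sympDual n).apply_symm_apply g)

/-- The symplectic gradient of half the squared gauge of `X`. -/
noncomputable def hamiltonianField (X : Set (SympSpace n)) (x : SympSpace n) : SympSpace n :=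
  gauge X x • (sympDual n).symm (fderiv ℝ (gauge X) x)

theorem sympForm_hamiltonianField (X : Set (SympSpace n)) (x v : SympSpace n) :
    sympForm v (hamiltonianField X x) = gauge X x * fderiv ℝ (gauge X) x v := by
  rw [hamiltonianField, sympForm_smul_right, sympForm_sympDual_symm]

theorem hamiltonianField_smul {X : Set (SympSpace n)} {t : ℝ} (ht : 0 < t) (x : SympSpace n) :
    hamiltonianField X (t • x) = t • hamiltonianField X x := by
  rw [hamiltonianField, hamiltonianField, fderiv_gauge_smul ht, gauge_smul_of_nonneg ht.le,
    smul_smul, smul_eq_mul]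

theorem fderiv_hamiltonianField_smul {X : Set (SympSpace n)} {t : ℝ} (ht : 0 < t)
    (x : SympSpace n) :
    fderiv ℝ (hamiltonianField X) (t • x) = fderiv ℝ (hamiltonianField X) x := by
  have h1 : hamiltonianField X = t⁻¹ • fun u => hamiltonianField X (t • u) := by
    ext1 u
    rw [Pi.smul_apply, hamiltonianField_smul ht, smul_smul, inv_mul_cancel₀ ht.ne', one_smul]
  conv_rhs => rw [h1]
  rw [fderiv_const_smul_field, Pi.smul_apply, fderiv_comp_smul, smul_smul,
    inv_mul_cancel₀ ht.ne', one_smul]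

variable {X : ConvexBody (SympSpace n)}

theorem contDiffAt_hamiltonianField
    (h0 : (0 : SympSpace n) ∈ interior (X : Set (SympSpace n)))
    (hX : HasSmoothBoundary ∞ (X : Set (SympSpace n)))
    {x : SympSpace n} (hx : x ≠ 0) : ContDiffAt ℝ ∞ (hamiltonianField X) x := by
  have h1 := gauge_contDiffAt h0 hX hx
  exact h1.smul ((sympDual n).symm.contDiff.contDiffAt.comp x
    (h1.fderiv_right (m := ∞) (by norm_cast)))

theorem hasFDerivAt_hamiltonianField
    (h0 : (0 : SympSpace n) ∈ interior (X : Set (SympSpace n)))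
    (hX : HasSmoothBoundary ∞ (X : Set (SympSpace n)))
    {x : SympSpace n} (hx : x ≠ 0) :
    HasFDerivAt (hamiltonianField X) (fderiv ℝ (hamiltonianField X) x) x :=
  ((contDiffAt_hamiltonianField h0 hX hx).differentiableAt (by simp)).hasFDerivAt

theorem sympForm_self_hamiltonianField
    (h0 : (0 : SympSpace n) ∈ interior (X : Set (SympSpace n)))
    (hX : HasSmoothBoundary ∞ (X : Set (SympSpace n)))
    {x : SympSpace n} (hx : x ≠ 0) :
    sympForm x (hamiltonianField X x) = gauge (X : Set (SympSpace n)) x ^ 2 := by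
  rw [sympForm_hamiltonianField, fderiv_gauge_self h0 hX hx, sq]

theorem sympForm_hamiltonianField_le
    (h0 : (0 : SympSpace n) ∈ interior (X : Set (SympSpace n)))
    (hX : HasSmoothBoundary ∞ (X : Set (SympSpace n)))
    {x : SympSpace n} (hx : x ≠ 0) (v : SympSpace n) :
    sympForm v (hamiltonianField X x) ≤ gauge (X : Set (SympSpace n)) v * gauge (X : Set
        (SympSpace n)) x := by
  rw [sympForm_hamiltonianField, mul_comm]
  exact mul_le_mul_of_nonneg_right (fderiv_gauge_le h0 hX hx v) (gauge_nonneg x)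

theorem hamiltonianField_pos
    (h0 : (0 : SympSpace n) ∈ interior (X : Set (SympSpace n)))
    (hX : HasSmoothBoundary ∞ (X : Set (SympSpace n)))
    {x : SympSpace n} (hx : x ≠ 0) : 0 < sympForm x (hamiltonianField X x) := by
  rw [sympForm_self_hamiltonianField h0 hX hx]
  exact pow_pos (gauge_pos_of_ne_zero h0 hx) 2

theorem hamiltonianField_ne_zero
    (h0 : (0 : SympSpace n) ∈ interior (X : Set (SympSpace n)))
    (hX : HasSmoothBoundary ∞ (X : Set (SympSpace n)))
    {x : SympSpace n} (hx : x ≠ 0) : hamiltonianField X x ≠ 0 := by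
  intro h
  have := hamiltonianField_pos h0 hX hx
  rw [h, ← sympFormL_apply, map_zero] at this
  exact lt_irrefl _ this

theorem fderiv_hamiltonianField_self
    (h0 : (0 : SympSpace n) ∈ interior (X : Set (SympSpace n)))
    (hX : HasSmoothBoundary ∞ (X : Set (SympSpace n)))
    {x : SympSpace n} (hx : x ≠ 0) :
    fderiv ℝ (hamiltonianField X) x x = hamiltonianField X x := by
  have hline : HasDerivAt (fun t : ℝ => t • x) x 1 := by
    simpa using (hasDerivAt_id (1 : ℝ)).smul_const x
  have hcomp : HasDerivAt (fun t : ℝ => hamiltonianField X (t • x)) (fderiv ℝ (hamiltonianField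
      X) x x) 1 :=
    HasFDerivAt.comp_hasDerivAt (l := hamiltonianField (X : Set (SympSpace n))) 1
      (by simpa using hasFDerivAt_hamiltonianField h0 hX hx) hline
  have h2 : HasDerivAt (fun t : ℝ => t • hamiltonianField X x) (hamiltonianField X x) 1 := by
    simpa using (hasDerivAt_id (1 : ℝ)).smul_const (hamiltonianField X x)
  refine hcomp.unique (h2.congr_of_eventuallyEq ?_)
  filter_upwards [lt_mem_nhds (zero_lt_one (α := ℝ))] with t ht
  exact hamiltonianField_smul ht x

/-- Both sides are the Hessian of half the squared gauge. -/
theorem fderiv_hamiltonianField_symm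
    (h0 : (0 : SympSpace n) ∈ interior (X : Set (SympSpace n)))
    (hX : HasSmoothBoundary ∞ (X : Set (SympSpace n)))
    {x : SympSpace n} (hx : x ≠ 0) (u v : SympSpace n) :
    sympForm u (fderiv ℝ (hamiltonianField X) x v) = sympForm v (fderiv ℝ (hamiltonianField X) x
        u) := by
  have hg := gauge_contDiffAt h0 hX hx
  have hgd := (hg.differentiableAt (by simp)).hasFDerivAt
  have hg2 := ((hg.fderiv_right (m := 1) (by norm_cast)).differentiableAt (by simp)).hasFDerivAt
  have hsymm := (hg.isSymmSndFDerivAt (by simp; norm_cast)).eq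
  have key : ∀ u v, sympForm u (fderiv ℝ (hamiltonianField X) x v)
      = gauge (X : Set (SympSpace n)) x * fderiv ℝ (fderiv ℝ (gauge (X : Set (SympSpace n)))) x v
          u + fderiv ℝ (gauge (X : Set (SympSpace n))) x v * fderiv ℝ (gauge (X : Set (SympSpace
          n))) x u := by
    intro u v
    have h1 := (sympFormL n u).hasFDerivAt.comp x (hasFDerivAt_hamiltonianField h0 hX hx)
    have h2 := hgd.mul (hg2.clm_apply (hasFDerivAt_const u x))
    have h3 := h2.congr_of_eventuallyEq (f₁ := sympFormL n u ∘ hamiltonianField X)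
      (Filter.Eventually.of_forall fun y => sympForm_hamiltonianField _ y u)
    have := congrArg (fun L : SympSpace n →L[ℝ] ℝ => L v) (h1.unique h3)
    simp at this
    rw [this, mul_comm (fderiv ℝ (gauge (X : Set (SympSpace n))) x v)]
  rw [key, key, hsymm, mul_comm (fderiv ℝ (gauge (X : Set (SympSpace n))) x v)]

/-- Infinitesimal form of the monotonicity of the gradient of a convex function. The increment of
the field from `x` to `y`, paired with `y - x`, is at least `(gauge x - gauge y)²`, by
`sympForm_hamiltonianField_le`. -/
theorem sympForm_fderiv_hamiltonianField_nonneg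
    (h0 : (0 : SympSpace n) ∈ interior (X : Set (SympSpace n)))
    (hX : HasSmoothBoundary ∞ (X : Set (SympSpace n)))
    {x : SympSpace n} (hx : x ≠ 0)
    (v : SympSpace n) : 0 ≤ sympForm v (fderiv ℝ (hamiltonianField X) x v) := by
  have hline : HasDerivAt (fun t : ℝ => x + t • v) v 0 := by
    simpa using ((hasDerivAt_id (0 : ℝ)).smul_const v).const_add x
  have hcomp : HasDerivAt (fun t : ℝ => sympFormL n v (hamiltonianField X (x + t • v)))
      (sympFormL n v (fderiv ℝ (hamiltonianField X) x v)) 0 :=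
    (sympFormL n v).hasFDerivAt.comp_hasDerivAt 0
      (HasFDerivAt.comp_hasDerivAt (l := hamiltonianField (X : Set (SympSpace n))) 0
        (by simpa using hasFDerivAt_hamiltonianField h0 hX hx) hline)
  refine ge_of_tendsto hcomp.tendsto_slope_zero_right ?_
  have hne : ∀ᶠ t : ℝ in 𝓝[>] 0, x + t • v ≠ 0 :=
    (hline.continuousAt.eventually_ne (by simpa using hx)).filter_mono nhdsWithin_le_nhds
  filter_upwards [self_mem_nhdsWithin, hne] with t ht ht0
  have ht' : (0 : ℝ) < t := ht
  set y := x + t • v with hy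
  have hxy := sympForm_hamiltonianField_le h0 hX ht0 x
  have hyx := sympForm_hamiltonianField_le h0 hX hx y
  have hxx := sympForm_self_hamiltonianField h0 hX hx
  have hyy := sympForm_self_hamiltonianField h0 hX ht0
  have h1 : t * (sympForm v (hamiltonianField X y) - sympForm v (hamiltonianField X x))
      = sympForm y (hamiltonianField X y) - sympForm x (hamiltonianField X y) - sympForm y
          (hamiltonianField X x) + sympForm x (hamiltonianField X x) := by
    have e1 : ∀ z, sympForm y z = sympForm x z + t * sympForm v z := fun z => by
      rw [hy, sympForm_add_left, sympForm_smul_left]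
    rw [e1, e1]; ring
  have h2 : 0 ≤ t * (sympForm v (hamiltonianField X y) - sympForm v (hamiltonianField X x)) := by
    rw [h1]; nlinarith [sq_nonneg (gauge (X : Set (SympSpace n)) x - gauge (X : Set (SympSpace
        n)) y)]
  simp only [zero_add, zero_smul, add_zero, smul_eq_mul, sympFormL_apply]
  exact mul_nonneg (inv_nonneg.2 ht'.le) (nonneg_of_mul_nonneg_right h2 ht')

theorem hamiltonianField_mem_polar
    (h0 : (0 : SympSpace n) ∈ interior (X : Set (SympSpace n)))
    (hX : HasSmoothBoundary ∞ (X : Set (SympSpace n)))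
    {x : SympSpace n}
    (hx : x ∈ frontier (X : Set (SympSpace n))) :
    hamiltonianField X x ∈ frontier (symplecticPolar (X : Set (SympSpace n))) ∧ sympForm x
        (hamiltonianField X x) = 1 := by
  have hx0 := ne_zero_of_mem_frontier h0 hx
  have hg1 : gauge (X : Set (SympSpace n)) x = 1 :=
    (gauge_eq_one_iff_mem_frontier X.convex (mem_interior_iff_mem_nhds.1 h0)).2 hx
  have h1 : sympForm x (hamiltonianField X x) = 1 := by
    rw [sympForm_self_hamiltonianField h0 hX hx0, hg1, one_pow]
  have hmem : hamiltonianField X x ∈ symplecticPolar (X : Set (SympSpace n)) := by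
    intro a ha
    refine (sympForm_hamiltonianField_le h0 hX hx0 a).trans ?_
    rw [hg1, mul_one]
    exact gauge_le_one_of_mem ha
  refine ⟨⟨subset_closure hmem, fun hint => ?_⟩, h1⟩
  -- If the point were interior to the polar, a dilate by some `s > 1` would still lie in it, yet
  -- its pairing with `x` is `s`.
  have htend : Filter.Tendsto (fun s : ℝ => s • hamiltonianField X x) (𝓝[>] 1) (𝓝
      (hamiltonianField X x)) := by
    have : Continuous fun s : ℝ => s • hamiltonianField X x := by fun_prop
    simpa using (this.tendsto 1).mono_left nhdsWithin_le_nhds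
  obtain ⟨s, hs1, hs2⟩ := ((htend.eventually (mem_interior_iff_mem_nhds.mp hint)).and
    self_mem_nhdsWithin).exists
  have h2 : sympForm x (s • hamiltonianField X x) ≤ 1 := hs1 x (X.isClosed.frontier_subset hx)
  rw [sympForm_smul_right, h1, mul_one] at h2
  exact absurd h2 (not_le.2 hs2)

theorem eq_hamiltonianField
    (h0 : (0 : SympSpace n) ∈ interior (X : Set (SympSpace n)))
    (hX : HasSmoothBoundary ∞ (X : Set (SympSpace n)))
    {x y : SympSpace n}
    (hx : x ∈ frontier (X : Set (SympSpace n)))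
    (hy : y ∈ frontier (symplecticPolar (X : Set (SympSpace n))) ∧ sympForm x y = 1) :
    y = hamiltonianField X x :=
  (existsUnique_polarityMap X h0 (hX.of_le (by norm_cast)) hx).unique hy
    (hamiltonianField_mem_polar h0 hX hx)

theorem polarityMap_eq_hamiltonianField
    (h0 : (0 : SympSpace n) ∈ interior (X : Set (SympSpace n)))
    (hX : HasSmoothBoundary ∞ (X : Set (SympSpace n)))
    {x : SympSpace n}
    (hx : x ∈ frontier (X : Set (SympSpace n))) :
    polarityMap (X : Set (SympSpace n)) x = hamiltonianField X x :=
  eq_hamiltonianField h0 hX hx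
    (Classical.epsilon_spec (p := fun y =>
      y ∈ frontier (symplecticPolar (X : Set (SympSpace n))) ∧ sympForm x y = 1)
      ⟨hamiltonianField X x, hamiltonianField_mem_polar h0 hX hx⟩)

theorem boundaryTangent_eq
    (h0 : (0 : SympSpace n) ∈ interior (X : Set (SympSpace n)))
    (hX : HasSmoothBoundary ∞ (X : Set (SympSpace n)))
    {x : SympSpace n} (hx : x ∈ frontier (X : Set (SympSpace n))) :
    boundaryTangent (X : Set (SympSpace n)) x = {v | sympForm v (hamiltonianField X x) = 0} := by
  have hx0 := ne_zero_of_mem_frontier h0 hx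
  have hg1 : gauge (X : Set (SympSpace n)) x = 1 :=
    (gauge_eq_one_iff_mem_frontier X.convex (mem_interior_iff_mem_nhds.1 h0)).2 hx
  obtain ⟨hF, hxF⟩ := hamiltonianField_mem_polar h0 hX hx
  ext v
  constructor
  · rintro ⟨ρ, hρ, hv⟩
    exact hρ.supporting_eq_zero X.isClosed hx (l := (sympFormL n).flip (hamiltonianField X x))
      ((isClosed_symplecticPolar _).frontier_subset hF) hxF hv
  · intro hv
    have hv' : fderiv ℝ (gauge (X : Set (SympSpace n))) x v = 0 := by
      have : sympForm v (hamiltonianField X x) = 0 := hv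
      rwa [sympForm_hamiltonianField, hg1, one_mul] at this
    refine ⟨fun y => gauge (X : Set (SympSpace n)) y - 1, ⟨{0}ᶜ, isOpen_compl_singleton, hx0, ?_,
        ?_, ?_⟩, ?_⟩
    · intro y hy
      exact (((gauge_contDiffAt h0 hX hy).of_le (by norm_cast)).sub
        contDiffAt_const).contDiffWithinAt
    · intro y _
      rw [mem_iff_gauge_le_one h0, sub_nonpos]
    · rw [fderiv_sub_const]
      intro h
      have := fderiv_gauge_self h0 hX hx0
      rw [h, hg1] at this
      simp at this
    · rw [fderiv_sub_const, hv']

theorem mem_characteristicLine_iff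
    (h0 : (0 : SympSpace n) ∈ interior (X : Set (SympSpace n)))
    (hX : HasSmoothBoundary ∞ (X : Set (SympSpace n)))
    {x : SympSpace n}
    (hx : x ∈ frontier (X : Set (SympSpace n))) {v : SympSpace n} :
    v ∈ characteristicLine (X : Set (SympSpace n)) x ↔ ∃ c : ℝ, v = c • hamiltonianField X x := by
  obtain ⟨-, hxF⟩ := hamiltonianField_mem_polar h0 hX hx
  rw [characteristicLine, boundaryTangent_eq h0 hX hx]
  constructor
  · rintro ⟨-, hv⟩
    refine ⟨sympForm x v, sympForm_ext fun u => ?_⟩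
    -- Project an arbitrary `u` along `x` onto the tangent space; the pairing of `x` with the field
    -- is `1`.
    have h1 := hv (u + (-sympForm u (hamiltonianField X x)) • x) (by
      change sympForm _ _ = 0
      rw [sympForm_add_left, sympForm_smul_left, hxF]; ring)
    rw [sympForm_neg_swap, sympForm_add_left, sympForm_smul_left] at h1
    rw [sympForm_smul_right]
    linarith
  · rintro ⟨c, rfl⟩
    refine ⟨?_, fun w hw => ?_⟩
    · change sympForm _ _ = 0
      rw [sympForm_smul_left, sympForm_self, mul_zero]
    · have hw' : sympForm w (hamiltonianField X x) = 0 := hw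
      rw [sympForm_smul_left, sympForm_neg_swap, hw', neg_zero, mul_zero]

/-- An integral curve of the Hamiltonian field stays on the boundary because the gauge is conserved:
its derivative along the field is proportional to `ω(F, F) = 0`. -/
theorem exists_characteristicCurve
    (h0 : (0 : SympSpace n) ∈ interior (X : Set (SympSpace n)))
    (hX : HasSmoothBoundary ∞ (X : Set (SympSpace n)))
    {x : SympSpace n}
    (hx : x ∈ frontier (X : Set (SympSpace n))) :
    ∃ (γ : ℝ → SympSpace n) (I : Set ℝ), IsOpen I ∧ I.OrdConnected ∧ (0 : ℝ) ∈ I ∧ γ 0 = x ∧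
      IsCharacteristicCurve (X : Set (SympSpace n)) I γ ∧ ∀ t ∈ I, HasDerivAt γ (hamiltonianField
          X (γ t)) t := by
  have hx0 := ne_zero_of_mem_frontier h0 hx
  obtain ⟨γ, hγ0, ε, hε, hγ⟩ :=
    ((contDiffAt_hamiltonianField h0 hX hx0).of_le (by norm_cast :
      (1 : WithTop ℕ∞) ≤ ∞)).exists_forall_mem_closedBall_exists_eq_forall_mem_Ioo_hasDerivAt₀ 0
  have hc0 : ContinuousAt γ 0 := (hγ 0 (by simp [hε])).continuousAt
  -- Shrink the time interval so that the curve also avoids the origin, where the gauge need not be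
  -- smooth.
  obtain ⟨δ, hδ, hδγ⟩ := Metric.eventually_nhds_iff_ball.1
    ((hc0.eventually_ne (by rwa [hγ0])).and (Ioo_mem_nhds (by linarith : 0 - ε < 0)
      (by linarith : 0 < 0 + ε)))
  set I := Metric.ball (0 : ℝ) δ with hI
  have hIo : IsOpen I := Metric.isOpen_ball
  have hIc : I.OrdConnected := by rw [hI, Real.ball_eq_Ioo]; exact Set.ordConnected_Ioo
  have hI0 : (0 : ℝ) ∈ I := Metric.mem_ball_self hδ
  have hder : ∀ t ∈ I, HasDerivAt γ (hamiltonianField X (γ t)) t := fun t ht => hγ t (hδγ t ht).2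
  have hne : ∀ t ∈ I, γ t ≠ 0 := fun t ht => (hδγ t ht).1
  have hgder : ∀ t ∈ I, HasDerivAt (fun t => gauge (X : Set (SympSpace n)) (γ t)) 0 t := by
    intro t ht
    have h1 := ((gauge_contDiffAt h0 hX (hne t ht)).differentiableAt
      (by simp)).hasFDerivAt.comp_hasDerivAt t (hder t ht)
    have h2 := sympForm_hamiltonianField (X : Set (SympSpace n)) (γ t) (hamiltonianField X (γ t))
    rw [sympForm_self, eq_comm, mul_eq_zero,
      or_iff_right (gauge_pos_of_ne_zero h0 (hne t ht)).ne'] at h2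
    rw [h2] at h1
    exact h1
  have hfr : ∀ t ∈ I, γ t ∈ frontier (X : Set (SympSpace n)) := by
    intro t ht
    have h1 : gauge (X : Set (SympSpace n)) (γ t) = gauge (X : Set (SympSpace n)) (γ 0) :=
      hIo.is_const_of_deriv_eq_zero (Set.OrdConnected.isPreconnected hIc)
        (fun t ht => (hgder t ht).differentiableAt.differentiableWithinAt)
        (fun t ht => (hgder t ht).deriv) ht hI0
    rw [hγ0, (gauge_eq_one_iff_mem_frontier X.convex (mem_interior_iff_mem_nhds.1 h0)).2 hx] at h1
    exact (gauge_eq_one_iff_mem_frontier X.convex (mem_interior_iff_mem_nhds.1 h0)).1 h1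
  refine ⟨γ, I, hIo, hIc, hI0, hγ0, ⟨?_, fun t ht => ⟨hfr t ht, ?_, ?_⟩⟩, hder⟩
  · rw [show (1 : WithTop ℕ∞) = 0 + 1 by simp, contDiffOn_succ_iff_deriv_of_isOpen hIo]
    refine ⟨fun t ht => (hder t ht).differentiableAt.differentiableWithinAt, by simp, ?_⟩
    rw [contDiffOn_zero]
    intro t ht
    have h1 : ContinuousAt (fun t => hamiltonianField X (γ t)) t :=
      ContinuousAt.comp (g := hamiltonianField (X : Set (SympSpace n)))
          (contDiffAt_hamiltonianField h0 hX (hne t ht)).continuousAt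
        (hder t ht).continuousAt
    refine (h1.congr ?_).continuousWithinAt
    filter_upwards [hIo.mem_nhds ht] with s hs
    exact (hder s hs).deriv.symm
  · rw [(hder t ht).deriv]
    exact hamiltonianField_ne_zero h0 hX (hne t ht)
  · rw [(hder t ht).deriv, mem_characteristicLine_iff h0 hX (hfr t ht)]
    exact ⟨1, (one_smul _ _).symm⟩

end HamiltonianField

/-! ### The hypotheses on `X` translated to the Hamiltonian field. -/

section Main

variable {n : ℕ} {X : ConvexBody (SympSpace n)}

/-- The image of the integral curve through a boundary point `x` has velocity `DF(x) F(x)` there,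
and the characteristic line at `F x` is spanned by `F (F x) = -x`. Homogeneity extends this off the
boundary. -/
theorem planar_of_mapsCharacteristics
    (h0 : (0 : SympSpace n) ∈ interior (X : Set (SympSpace n)))
    (hX : HasSmoothBoundary ∞ (X : Set (SympSpace n)))
    (hinv : ∀ x, x ≠ 0 → hamiltonianField (X : Set (SympSpace n)) (hamiltonianField (X : Set
        (SympSpace n)) x) = -x)
    (hf : MapsCharacteristics (X : Set (SympSpace n)) (polarityMap (X : Set (SympSpace n))))
    {x : SympSpace n} (hx : x ≠ 0) :
    ∃ m : ℝ, fderiv ℝ (hamiltonianField (X : Set (SympSpace n))) x (hamiltonianField (X : Set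
        (SympSpace n)) x) = m • x := by
  have hfr : ∀ x ∈ frontier (X : Set (SympSpace n)),
      ∃ m : ℝ, fderiv ℝ (hamiltonianField (X : Set (SympSpace n))) x (hamiltonianField (X : Set
          (SympSpace n)) x) = m • x := by
    intro x hx
    have hx0 := ne_zero_of_mem_frontier h0 hx
    obtain ⟨γ, I, hIo, hIc, hI0, hγ0, hγ, hder⟩ := exists_characteristicCurve h0 hX hx
    obtain ⟨-, h1⟩ := hf I γ hIo hIc hγ
    obtain ⟨hmem, -, hline⟩ := h1 0 hI0
    rw [mem_characteristicLine_iff h0 hX hmem] at hline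
    obtain ⟨c, hc⟩ := hline
    have hd : HasDerivAt (hamiltonianField (X : Set (SympSpace n)) ∘ γ)
        (fderiv ℝ (hamiltonianField (X : Set (SympSpace n))) x (hamiltonianField (X : Set
            (SympSpace n)) x)) 0 := by
      have h2 := hasFDerivAt_hamiltonianField h0 hX hx0
      have h3 := hder 0 hI0
      rw [hγ0] at h3
      rw [← hγ0] at h2
      have := h2.comp_hasDerivAt 0 h3
      rwa [hγ0] at this
    have heq : (polarityMap (X : Set (SympSpace n)) ∘ γ) =ᶠ[𝓝 0] (hamiltonianField (X : Set
        (SympSpace n)) ∘ γ) := by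
      filter_upwards [hIo.mem_nhds hI0] with t ht
      exact polarityMap_eq_hamiltonianField h0 hX (hγ.2 t ht).1
    rw [heq.deriv_eq, hd.deriv, Function.comp_apply, hγ0,
      polarityMap_eq_hamiltonianField h0 hX hx, hinv x hx0] at hc
    exact ⟨-c, by rw [hc, neg_smul, smul_neg]⟩
  have hg := inv_pos.2 (gauge_pos_of_ne_zero h0 hx)
  obtain ⟨m, hm⟩ := hfr _ (normalize_mem_frontier h0 hx)
  rw [fderiv_hamiltonianField_smul hg, hamiltonianField_smul hg, map_smul, smul_comm] at hm
  exact ⟨m, smul_right_injective _ hg.ne' hm⟩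

/-- A self-polar body is centrally symmetric, so `-x` is a boundary point, and its pairing with `F
x` is `1`; uniqueness of the polar point identifies it with `F (F x)`. -/
theorem hamiltonianField_involutive
    (h0 : (0 : SympSpace n) ∈ interior (X : Set (SympSpace n)))
    (hX : HasSmoothBoundary ∞ (X : Set (SympSpace n)))
    (hpolar : IsSymplecticallySelfPolar (X : Set (SympSpace n)))
    {x : SympSpace n} (hx : x ≠ 0) : hamiltonianField (X : Set (SympSpace n)) (hamiltonianField
        (X : Set (SympSpace n)) x) = -x := by
  have hsymm : ∀ y ∈ (X : Set (SympSpace n)), -y ∈ (X : Set (SympSpace n)) := by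
    intro y hy
    rw [hpolar]
    intro z hz
    rw [hpolar] at hz
    have := hz y hy
    rwa [← neg_one_smul ℝ y, sympForm_smul_right, sympForm_neg_swap, neg_one_mul, neg_neg]
  have hfr : ∀ x ∈ frontier (X : Set (SympSpace n)),
      hamiltonianField (X : Set (SympSpace n)) (hamiltonianField (X : Set (SympSpace n)) x) = -x
          := by
    intro x hx
    obtain ⟨h1, h2⟩ := hamiltonianField_mem_polar h0 hX hx
    rw [← hpolar] at h1
    refine (eq_hamiltonianField h0 hX h1 ⟨?_, ?_⟩).symm
    · rw [← hpolar, ← gauge_eq_one_iff_mem_frontier X.convex (mem_interior_iff_mem_nhds.1 h0),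
        gauge_neg hsymm]
      exact (gauge_eq_one_iff_mem_frontier X.convex (mem_interior_iff_mem_nhds.1 h0)).2 hx
    · rw [← neg_one_smul ℝ x, sympForm_smul_right, sympForm_neg_swap, h2]; norm_num
  have hg := inv_pos.2 (gauge_pos_of_ne_zero h0 hx)
  have h1 := hfr _ (normalize_mem_frontier h0 hx)
  rw [hamiltonianField_smul hg, hamiltonianField_smul hg, ← smul_neg] at h1
  exact smul_right_injective _ hg.ne' h1

theorem finrank_sympSpace : Module.finrank ℝ (SympSpace n) = 2 * n := by
  simp [two_mul]

theorem exists_ne_zero_sympForm_eq_zero (hn : 2 ≤ n) (x y : SympSpace n) :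
    ∃ v, v ≠ 0 ∧ sympFormL n v x = 0 ∧ sympFormL n v y = 0 := by
  set l : SympSpace n →ₗ[ℝ] ℝ × ℝ :=
    (((sympFormL n).flip x).prod ((sympFormL n).flip y)).toLinearMap with hl
  have : l.ker ≠ ⊥ := LinearMap.ker_ne_bot_of_finrank_lt (by
    rw [finrank_sympSpace, Module.finrank_prod, Module.finrank_self]; omega)
  obtain ⟨v, hv, hv0⟩ := Submodule.exists_mem_ne_zero_of_ne_bot this
  have hv' : (sympFormL n v x, sympFormL n v y) = (0, 0) := hv
  exact ⟨v, hv0, congrArg Prod.fst hv', congrArg Prod.snd hv'⟩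

/-- The coordinates indexed by `s`, as complex numbers. -/
noncomputable def complexCoordinates (s : Fin n → Fin n ⊕ Fin n) :
    SympSpace n →L[ℝ] EuclideanSpace ℂ (Fin n) :=
  LinearMap.toContinuousLinearMap
    { toFun := fun x => WithLp.toLp 2 fun i => (x (s i) : ℂ)
      map_add' := fun x y => by ext i; simp
      map_smul' := fun c x => by ext i; simp }

@[simp]
theorem complexCoordinates_apply (s : Fin n → Fin n ⊕ Fin n) (x : SympSpace n) (i : Fin n) :
    complexCoordinates s x i = (x (s i) : ℂ) := rfl

theorem complexCoordinates_eq_zero {s : Fin n → Fin n ⊕ Fin n} {x : SympSpace n}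
    (h : complexCoordinates s x = 0) (i : Fin n) : x (s i) = 0 := by
  simpa using congrArg (fun z : EuclideanSpace ℂ (Fin n) => z i) h

theorem complexCoordinates_real {s : Fin n → Fin n ⊕ Fin n} {x y : SympSpace n}
    (h : complexCoordinates s x = Complex.I • complexCoordinates s y) :
    complexCoordinates s x = 0 ∧ complexCoordinates s y = 0 := by
  have h1 : ∀ i, (x (s i) : ℂ) = Complex.I * (y (s i) : ℂ) := fun i => by
    simpa using congrArg (fun z : EuclideanSpace ℂ (Fin n) => z i) h
  constructor
  · ext i
    have := congrArg Complex.re (h1 i)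
    simp at this
    simp [this]
  · ext i
    have := congrArg Complex.im (h1 i)
    simp at this
    simp [← this]

/-- If the differential of the Hamiltonian field is everywhere a complex structure, then it is
constant. -/
theorem fderiv_hamiltonianField_eq
    (h0 : (0 : SympSpace n) ∈ interior (X : Set (SympSpace n)))
    (hX : HasSmoothBoundary ∞ (X : Set (SympSpace n)))
    (hJ : ∀ x, x ≠ 0 → ∀ v,
      fderiv ℝ (hamiltonianField (X : Set (SympSpace n))) x (fderiv ℝ (hamiltonianField (X : Set
          (SympSpace n))) x v) = -v)
    (hrank : 1 < Module.rank ℝ (SympSpace n))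
    {x y : SympSpace n} (hx : x ≠ 0) (hy : y ≠ 0) :
    fderiv ℝ (hamiltonianField (X : Set (SympSpace n))) x = fderiv ℝ (hamiltonianField (X : Set
        (SympSpace n))) y := by
  refine fderiv_eq_of_comp_self_eq_neg (σ := sympFormL n)
    (q := complexCoordinates Sum.inl) (p := complexCoordinates Sum.inr) hrank
    (fun x hx => contDiffAt_hamiltonianField h0 hX hx)
    (fun t ht x _ => fderiv_hamiltonianField_smul ht x) hJ ?_ ?_ ?_
    (fun u v h => complexCoordinates_real h) (fun u v h => complexCoordinates_real h) ?_ hx hy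
  · intro x hx v hv
    have hnn := sympForm_fderiv_hamiltonianField_nonneg h0 hX hx
    have hsy := fderiv_hamiltonianField_symm h0 hX hx
    set D := fderiv ℝ (hamiltonianField (X : Set (SympSpace n))) x
    -- A null vector of the positive semidefinite form `ω(·, D ·)` lies in its radical.
    have hDv : D v = 0 := by
      apply sympForm_nondegenerate
      intro u
      have hquad : ∀ t : ℝ, 0 ≤ 2 * t * sympForm u (D v) + t * t * sympForm u (D u) := by
        intro t
        have h1 := hnn (v + t • u)
        have h2 : sympForm v (D v) = 0 := hv
        have h3 : ∀ a b, sympForm (v + t • u) (a + t • b) = sympForm v a + t * sympForm v b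
            + t * sympForm u a + t * t * sympForm u b := by
          intro a b
          simp only [← sympFormL_apply, map_add, map_smul, FunLike.coe_add, FunLike.coe_smul,
            Pi.add_apply, Pi.smul_apply, smul_eq_mul]
          ring
        rw [map_add, map_smul, h3, h2, hsy v u] at h1
        linarith
      have h4 := hnn u
      by_contra hne
      set a := sympForm u (D v)
      set b := sympForm u (D u)
      -- For `b > 0` the minimiser would be `-a / b`; the shift by `1` also covers `b = 0` and still
      -- gives a negative value.
      have h5 := hquad (-a / (b + 1))
      have h6 : 2 * (-a / (b + 1)) * a + (-a / (b + 1)) * (-a / (b + 1)) * b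
          = -(a ^ 2 * (b + 2)) / (b + 1) ^ 2 := by
        field_simp; ring
      rw [h6] at h5
      have h7 : 0 < a ^ 2 * (b + 2) / (b + 1) ^ 2 := by positivity
      rw [neg_div] at h5
      linarith
    have := hJ x hx v
    change D (D v) = -v at this
    rw [hDv, map_zero] at this
    simpa using this.symm
  · rw [finrank_sympSpace, finrank_real_of_complex]
    simp
  · intro u v hu hv
    have h1 := complexCoordinates_eq_zero hu
    have h2 := complexCoordinates_eq_zero hv
    simp [sympForm, h1, h2]
  · intro u hu hv
    ext (i | i)
    · exact complexCoordinates_eq_zero hu i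
    · exact complexCoordinates_eq_zero hv i

end Main

/-! ### Conclusion: the squared gauge is a compatible quadratic form. -/

theorem corollary4p5 (n : ℕ) (hn : 2 ≤ n) (X : ConvexBody (SympSpace n))
    (h0 : (0 : SympSpace n) ∈ interior (X : Set (SympSpace n)))
    (hsmooth : HasSmoothBoundary ∞ (X : Set (SympSpace n)))
    (hpolar : IsSymplecticallySelfPolar (X : Set (SympSpace n)))
    (hf : MapsCharacteristics (X : Set (SympSpace n)) (polarityMap (X : Set (SympSpace n)))) :
    LinearlySymplectomorphic (X : Set (SympSpace n))
      (Metric.closedBall (0 : SympSpace n) 1) := by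
  have hrank : 1 < Module.rank ℝ (SympSpace n) := by
    rw [← Module.finrank_eq_rank, finrank_sympSpace]
    exact_mod_cast (by omega : 1 < 2 * n)
  have hinv : ∀ x, x ≠ 0 → hamiltonianField (X : Set (SympSpace n)) (hamiltonianField (X : Set
      (SympSpace n)) x) = -x := fun x hx =>
    hamiltonianField_involutive h0 hsmooth hpolar hx
  have hJ : ∀ x, x ≠ 0 → ∀ v,
      fderiv ℝ (hamiltonianField (X : Set (SympSpace n))) x (fderiv ℝ (hamiltonianField (X : Set
          (SympSpace n))) x v) = -v := fun x hx v =>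
    fderiv_comp_self_eq_neg (σ := sympFormL n) sympForm_self sympForm_nondegenerate hrank
      (fun x hx => contDiffAt_hamiltonianField h0 hsmooth hx)
      (fun x hx => fderiv_hamiltonianField_symm h0 hsmooth hx)
      (fun x hx => fderiv_hamiltonianField_self h0 hsmooth hx)
      (fun x hx => hamiltonianField_pos h0 hsmooth hx)
      (fun x hx => sympForm_fderiv_hamiltonianField_nonneg h0 hsmooth hx) hinv
      (fun x hx => planar_of_mapsCharacteristics h0 hsmooth hinv hf hx)
      (exists_ne_zero_sympForm_eq_zero hn) hx v
  have : Nontrivial (SympSpace n) := Module.nontrivial_of_finrank_pos (R := ℝ)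
    (by rw [finrank_sympSpace]; omega)
  obtain ⟨x₀, hx₀⟩ := exists_ne (0 : SympSpace n)
  set J := fderiv ℝ (hamiltonianField (X : Set (SympSpace n))) x₀ with hJdef
  -- Euler's identity `F x = DF(x) x` turns the constancy of the derivative into linearity of the
  -- field.
  have hFJ : ∀ x, x ≠ 0 → hamiltonianField (X : Set (SympSpace n)) x = J x := fun x hx => by
    rw [hJdef, fderiv_hamiltonianField_eq h0 hsmooth hJ hrank hx₀ hx,
      fderiv_hamiltonianField_self h0 hsmooth hx]
  have hgJ : ∀ x, gauge (X : Set (SympSpace n)) x ^ 2 = sympForm x (J x) := by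
    intro x
    rcases eq_or_ne x 0 with rfl | hx
    · simp [gauge_zero, sympForm]
    · rw [← hFJ x hx, sympForm_self_hamiltonianField h0 hsmooth hx]
  obtain ⟨Φ, hΦω, hΦn⟩ := exists_symplectic_orthonormal (J := J) (hJ x₀ hx₀)
    (fderiv_hamiltonianField_symm h0 hsmooth hx₀)
    (fun v hv => by rw [← hFJ v hv]; exact hamiltonianField_pos h0 hsmooth hv)
  refine ⟨Φ, hΦω, ?_⟩
  have hnorm : ∀ x, ‖Φ x‖ = gauge (X : Set (SympSpace n)) x := fun x =>
    (sq_eq_sq₀ (norm_nonneg _) (gauge_nonneg _)).1 (by rw [hΦn, hgJ])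
  ext y
  obtain ⟨x, rfl⟩ := Φ.surjective y
  rw [Φ.injective.mem_set_image, mem_closedBall_zero_iff, hnorm, mem_iff_gauge_le_one h0]
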